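/- For every $L\ge 0$ there is a constant $C(L)>0$, depending only on $L$, such that the following holds. Let $n\ge 2$, let $\lambda_0,\dots,\lambda_n$ be independent identically distributed complex-valued random variables with $\mathbb P\{\lambda_0=0\}=\mathbb P\{\lambda_n=0\}=0$, and let $P(z)=\sum_{k=0}^n\lambda_k z^k$. Call $\Gamma\subset\mathbb C$ an $L$-Lipschitz curve if $\Gamma=\{re^{i\theta(r)}\colon 0\le r<\infty\}$ for some real-valued function $\theta$ satisfying $|\theta(r_1)-\theta(r_2)|\le L\,|\log(r_1/r_2)|$ for all $r_1,r_2>0$, and for a set $S\subset\mathbb C$ let $N(S;P)$ be the number of zeroes of $P$ in $S$, counted with multiplicities. Then $$\sup\bigl\{\mathbb E[N(\Gamma;P)]\colon \Gamma \text{ is an } L\text{-Lipschitz curve}\bigr\}\le C(L)\,\log^4 n .$$ In particular, there is a numerical constant $C>0$ such that, for all $n\ge 2$ and all such $P$, $\mathbb E[N(\mathbb R;P)]\le C\log^4 n$. -/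

import Mathlib

open MeasureTheory ProbabilityTheory

noncomputable section

/-- The polynomial `∑_{k=0}^n a_k z^k` with coefficient vector `a ∈ ℂ^{n+1}`. -/
def coeffPoly {n : ℕ} (a : Fin (n + 1) → ℂ) : Polynomial ℂ :=
  ∑ k : Fin (n + 1), Polynomial.C (a k) * Polynomial.X ^ (k : ℕ)

open Classical in
/-- The number of zeroes of `P` lying in the set `S`, counted with multiplicities.
(By convention this is `0` for the zero polynomial.) -/
def zeroCount (S : Set ℂ) (P : Polynomial ℂ) : ℕ :=
  P.roots.countP (fun z => z ∈ S)

/-- `Γ` is an `L`-Lipschitz curve: `Γ = {r e^{iθ(r)} : 0 ≤ r < ∞}` for a real function `θ` with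
`|θ(r₁) - θ(r₂)| ≤ L |log (r₁ / r₂)|` for all `r₁, r₂ > 0`. -/
def IsLipschitzCurve (L : ℝ) (Γ : Set ℂ) : Prop :=
  ∃ θ : ℝ → ℝ,
    (∀ r₁ r₂ : ℝ, 0 < r₁ → 0 < r₂ → |θ r₁ - θ r₂| ≤ L * |Real.log (r₁ / r₂)|) ∧
    Γ = {z : ℂ | ∃ r : ℝ, 0 ≤ r ∧ z = (r : ℂ) * Complex.exp (Complex.I * (θ r : ℂ))}

/-- The random variables `ξ_0, …, ξ_n` are independent and identically distributed complex random
variables, and neither the constant nor the leading one vanishes with positive probability. -/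
structure IsNondegenerateIID {Ω : Type*} [MeasurableSpace Ω] (μ : Measure Ω) {n : ℕ}
    (ξ : Fin (n + 1) → Ω → ℂ) : Prop where
  measurable : ∀ k, Measurable (ξ k)
  indep : iIndepFun ξ μ
  identDistrib : ∀ j k, IdentDistrib (ξ j) (ξ k) μ μ
  constant_ne_zero : μ {ω | ξ 0 ω = 0} = 0
  leading_ne_zero : μ {ω | ξ (Fin.last n) ω = 0} = 0

end

/-!
The idea is to condition on the values of the coefficients and to average over their order only: the
coefficients are exchangeable, so it suffices to bound the mean of the zero count over all permutations
of given nonzero values `a_0, …, a_n` (`exists_sum_zeroCount_perm_le`,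
`IsNondegenerateIID.integral_zeroCount_le`).

On the logarithmic scale `s = log |z|` the terms `|a_k| |z| ^ k` are the exponentials of the lines
`s ↦ log |a_k| + k s`, and the break points of their upper envelope are the critical points. Away from
them one term dominates all others together, so that all zeroes are within distance `2` of critical
points (`exists_crit_near_root`). A critical point is determined by an index that is a record of the
sequence `|a_k|`, read forwards or backwards; hence a random arrangement has `O(log n)` critical points
on average (`sum_card_crit_le`).

Near a critical point the curve is covered by `O(log n)` arcs, each of them either of length `1 / n` or
short in comparison with its distance to all critical points (`exists_log_cover`). By Jensen's bound an
arc contains `O(log ^ 2 n)` zeroes, unless the polynomial is smaller than its largest term by a factor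
`exp (-C log ^ 2 n)` at all of `O(log n)` sample points near the centre of the arc
(`two_pow_zeroCount_curveArc_mul_le`).

It remains to show that a randomly ordered polynomial is that small with probability at most a high
negative power of `n` (`card_perms_small_le`). The tool is a weak form of Turán's lemma: a polynomial
with `O(log n)` terms is not small at the sample points (`turan_sample`). If only `O(log n)` of the
differences `a_k - a_{k-1}` are large, then `(1 - z) P` is essentially such a polynomial and `P` is not
small. Otherwise `O(log n)` disjoint pairs `a_{k-1}, a_k` with large differences can be interchanged
independently of each other; any two of the resulting polynomials differ by a polynomial with few
terms, so at most one of them is small (`card_flips_small_le`). Only the polynomially many arcs that can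
be attached to some arrangement have to be considered, which allows a union bound.
-/

/-! ### A weak form of Turán's lemma -/

/-- If the power sums `∑ c_k b_k ^ t`, `t < |K|`, with `δ`-separated nodes in the closed unit disk are all
bounded by `A`, then so are the coefficients up to a factor `(2 / δ) ^ (|K| - 1)`. The node `b_i` is
eliminated by passing to the sequence `p_{t+1} - b_i p_t`. -/
theorem norm_le_of_power_sums {ι : Type*} (K : Finset ι) (b : ι → ℂ)
    {δ : ℝ} (hδ : 0 < δ) (hb : ∀ i ∈ K, ‖b i‖ ≤ 1)
    (hsep : ∀ i ∈ K, ∀ j ∈ K, i ≠ j → δ ≤ ‖b i - b j‖) (c : ι → ℂ) (A : ℝ)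
    (hA : ∀ t < K.card, ‖∑ k ∈ K, c k * b k ^ t‖ ≤ A) (k : ι) (hk : k ∈ K) :
    ‖c k‖ ≤ (2 / δ) ^ (K.card - 1) * A := by
  classical
  induction hn : K.card generalizing K c A with
  | zero => rw [Finset.card_eq_zero] at hn; simp [hn] at hk
  | succ n ih =>
    rcases Nat.eq_zero_or_pos n with rfl | hn0
    · obtain ⟨x, rfl⟩ := Finset.card_eq_one.1 hn
      obtain rfl := Finset.mem_singleton.1 hk
      simpa using hA 0 (by simp)
    · obtain ⟨i, hi, hik⟩ : ∃ i ∈ K, i ≠ k :=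
        Finset.exists_mem_ne (by omega) k
      have hcard : (K.erase i).card = n := by rw [Finset.card_erase_of_mem hi, hn]; rfl
      have hsum : ∀ t, ∑ j ∈ K.erase i, (c j * (b j - b i)) * b j ^ t
          = (∑ j ∈ K, c j * b j ^ (t + 1)) - b i * ∑ j ∈ K, c j * b j ^ t := by
        intro t
        rw [Finset.mul_sum, ← Finset.sum_sub_distrib, ← Finset.add_sum_erase K _ hi]
        have : c i * b i ^ (t + 1) - b i * (c i * b i ^ t) = 0 := by ring
        rw [this, zero_add]
        exact Finset.sum_congr rfl fun j _ => by ring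
      have h := ih (K.erase i) (fun j hj => hb j (Finset.mem_of_mem_erase hj))
        (fun j hj l hl => hsep j (Finset.mem_of_mem_erase hj) l (Finset.mem_of_mem_erase hl))
        (fun j => c j * (b j - b i)) (2 * A) (by
          intro t ht
          rw [hcard] at ht
          rw [hsum]
          have h1 := hA (t + 1) (by omega)
          have h2 := hA t (by omega)
          calc _ ≤ ‖∑ j ∈ K, c j * b j ^ (t + 1)‖ + ‖b i * ∑ j ∈ K, c j * b j ^ t‖ := norm_sub_le _ _
            _ ≤ A + 1 * A := by
                rw [norm_mul]
                exact add_le_add h1 (mul_le_mul (hb i hi) h2 (norm_nonneg _) zero_le_one)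
            _ = 2 * A := by ring)
        (Finset.mem_erase.2 ⟨hik.symm, hk⟩) hcard
      rw [norm_mul] at h
      have hs := hsep k hk i hi hik.symm
      have h3 : ‖c k‖ * δ ≤ (2 / δ) ^ (n - 1) * (2 * A) :=
        (mul_le_mul_of_nonneg_left hs (norm_nonneg _)).trans h
      rw [← le_div_iff₀ hδ] at h3
      refine h3.trans (le_of_eq ?_)
      obtain ⟨m, rfl⟩ : ∃ m, n = m + 1 := ⟨n - 1, by omega⟩
      simp only [Nat.add_sub_cancel]
      rw [pow_succ]
      field_simp

theorem half_le_norm_exp_sub_exp {β : ℝ} (hβ : 0 < β) {N : ℕ} (hN : β * N ≤ 1) {i j : ℕ}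
    (hi : i ≤ N) (hj : j ≤ N) (hij : i ≠ j) :
    β / 2 ≤ ‖Complex.exp (Complex.I * (β * i : ℝ)) - Complex.exp (Complex.I * (β * j : ℝ))‖ := by
  wlog h : j < i generalizing i j
  · rw [norm_sub_rev]
    exact this hj hi hij.symm (by omega)
  have hx : Complex.exp (Complex.I * (β * i : ℝ)) - Complex.exp (Complex.I * (β * j : ℝ))
      = Complex.exp (Complex.I * (β * j : ℝ)) *
        (Complex.exp (Complex.I * ((β * (i - j) : ℝ) : ℂ)) - 1) := by
    rw [mul_sub, ← Complex.exp_add, mul_one]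
    congr 2
    push_cast
    ring
  rw [hx, norm_mul, Complex.norm_exp_I_mul_ofReal, one_mul, Complex.norm_exp_I_mul_ofReal_sub_one]
  set x : ℝ := β * (i - j) with hxdef
  have hij1 : (1 : ℝ) ≤ (i : ℝ) - j := by
    have : (j : ℝ) + 1 ≤ i := by exact_mod_cast h
    linarith
  have hxβ : β ≤ x := by nlinarith
  have hx1 : x ≤ 1 := by
    have : (i : ℝ) ≤ N := by exact_mod_cast hi
    have h0 : (0 : ℝ) ≤ j := Nat.cast_nonneg j
    nlinarith
  have hs : x / 4 ≤ Real.sin (x / 2) := by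
    have := Real.mul_le_sin (x := x / 2) (by linarith) (by linarith [Real.pi_gt_three])
    refine le_trans ?_ this
    have h4 : (1 : ℝ) / 2 ≤ 2 / Real.pi := by
      rw [div_le_div_iff₀ (by norm_num) Real.pi_pos]; linarith [Real.pi_le_four]
    nlinarith
  rw [Real.norm_eq_abs]
  exact le_trans (by linarith) (le_abs_self _)

/-- The `t`-th of the sample points obtained by rotating `w` in steps of angle `β`. -/
noncomputable def rotPoint (w : ℂ) (β : ℝ) (t : ℕ) : ℂ := w * Complex.exp (Complex.I * (β * t : ℝ))

theorem norm_rotPoint (w : ℂ) (β : ℝ) (t : ℕ) : ‖rotPoint w β t‖ = ‖w‖ := by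
  rw [rotPoint, norm_mul, Complex.norm_exp_I_mul_ofReal, mul_one]

/-- A weak form of Turán's lemma: a polynomial with at most `T` monomials is bounded below at one of
`T` consecutive sample points, with a loss that is exponential in `T`. -/
theorem turan_sample (K : Finset ℕ) (c : ℕ → ℂ) (w : ℂ) {β : ℝ} (hβ : 0 < β) {N T : ℕ}
    (hN : β * N ≤ 1) (hβ1 : β ≤ 1) (hK : ∀ k ∈ K, k ≤ N) (hT : K.card ≤ T) (A : ℝ) (hA0 : 0 ≤ A)
    (hA : ∀ t < T, ‖∑ k ∈ K, c k * rotPoint w β t ^ k‖ ≤ A) (k : ℕ) (hk : k ∈ K) :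
    (β / 4) ^ T * (‖c k‖ * ‖w‖ ^ k) ≤ A := by
  have h := norm_le_of_power_sums K (fun k => Complex.exp (Complex.I * (β * k : ℝ)))
    (δ := β / 2) (by linarith) (fun i _ => by rw [Complex.norm_exp_I_mul_ofReal])
    (fun i hi j hj hij => half_le_norm_exp_sub_exp hβ hN (hK i hi) (hK j hj) hij)
    (fun k => c k * w ^ k) A (by
      intro t ht
      refine le_trans (le_of_eq ?_) (hA t (ht.trans_le hT))
      congr 1
      refine Finset.sum_congr rfl fun k _ => ?_
      rw [rotPoint, mul_pow, mul_assoc, ← Complex.exp_nat_mul, ← Complex.exp_nat_mul]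
      congr 3
      push_cast
      ring) k hk
  rw [norm_mul, norm_pow] at h
  have h1 : (2 / (β / 2)) ^ (K.card - 1) ≤ (4 / β) ^ T := by
    have : 2 / (β / 2) = 4 / β := by field_simp; norm_num
    rw [this]
    exact pow_le_pow_right₀ (by rw [le_div_iff₀ hβ]; linarith) (by omega)
  have h2 := h.trans (mul_le_mul_of_nonneg_right h1 hA0)
  calc (β / 4) ^ T * (‖c k‖ * ‖w‖ ^ k) ≤ (β / 4) ^ T * ((4 / β) ^ T * A) := by gcongr
    _ = A := by
      rw [← mul_assoc, ← mul_pow]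
      have : β / 4 * (4 / β) = 1 := by field_simp
      rw [this, one_pow, one_mul]

/-- Passing from `P` to `(1 - z) P` does not decrease the largest term on a circle by more than a
factor `n + 1`; on circles of radius `r > 1` there is even a gain of a factor `r`. The coefficients of
`P` are sums of at most `n + 1` coefficients of `(1 - z) P`, taken from below or from above. -/
theorem exists_large_coeff_one_sub_mul {n : ℕ} (f q : ℕ → ℂ) (hf : f (n + 1) = 0) (hq0 : q 0 = f 0)
    (hq : ∀ k, q (k + 1) = f (k + 1) - f k) {r : ℝ} (hr : 0 < r) (k : ℕ) (hk : k ≤ n) :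
    ∃ j ≤ n + 1, max 1 r * (‖f k‖ * r ^ k) ≤ (n + 1) * (‖q j‖ * r ^ j) := by
  have hsum : ∀ k, ∑ j ∈ Finset.range (k + 1), q j = f k := by
    intro k
    induction k with
    | zero => simp [hq0]
    | succ k ih => rw [Finset.sum_range_succ, ih, hq]; ring
  by_contra! hcon
  have hpos : 0 ≤ ‖f k‖ * r ^ k := by positivity
  have key : ∀ s : Finset ℕ, s.Nonempty → s.card ≤ n + 1 → (∀ j ∈ s, j ≤ n + 1) →
      ‖f k‖ = ‖∑ j ∈ s, q j‖ → (∀ j ∈ s, max 1 r * r ^ k ≤ r ^ j) → False := by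
    intro s hs hcard hsn hfs hrs
    have h1 : max 1 r * (‖f k‖ * r ^ k) ≤ ∑ j ∈ s, ‖q j‖ * r ^ j := by
      calc _ = (max 1 r * r ^ k) * ‖∑ j ∈ s, q j‖ := by rw [hfs]; ring
        _ ≤ (max 1 r * r ^ k) * ∑ j ∈ s, ‖q j‖ := by
            gcongr
            exact norm_sum_le _ _
        _ = ∑ j ∈ s, ‖q j‖ * (max 1 r * r ^ k) := by rw [Finset.mul_sum]; simp only [mul_comm]
        _ ≤ _ := Finset.sum_le_sum fun j hj => by gcongr; exact hrs j hj
    have h2 : ∑ j ∈ s, ((n : ℝ) + 1) * (‖q j‖ * r ^ j)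
        < ∑ j ∈ s, max 1 r * (‖f k‖ * r ^ k) :=
      Finset.sum_lt_sum_of_nonempty hs fun j hj => hcon j (hsn j hj)
    rw [← Finset.mul_sum, Finset.sum_const, nsmul_eq_mul] at h2
    have h3 : (s.card : ℝ) ≤ n + 1 := by exact_mod_cast hcard
    have h4 : (s.card : ℝ) * (max 1 r * (‖f k‖ * r ^ k))
        ≤ (n + 1) * (max 1 r * (‖f k‖ * r ^ k)) := by gcongr
    have h5 : ((n : ℝ) + 1) * (max 1 r * (‖f k‖ * r ^ k))
        ≤ (n + 1) * ∑ j ∈ s, ‖q j‖ * r ^ j := by gcongr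
    linarith
  rcases le_total r 1 with h1 | h1
  · refine key (Finset.range (k + 1)) ⟨0, by simp⟩ (by simpa using hk)
      (fun j hj => by rw [Finset.mem_range] at hj; omega) (by rw [hsum]) (fun j hj => ?_)
    rw [max_eq_left h1, one_mul]
    rw [Finset.mem_range] at hj
    exact pow_le_pow_of_le_one hr.le h1 (by omega)
  · refine key (Finset.Ico (k + 1) (n + 2)) ⟨n + 1, by simp; omega⟩ (by simp)
      (fun j hj => by rw [Finset.mem_Ico] at hj; omega) ?_ (fun j hj => ?_)
    · rw [Finset.sum_Ico_eq_sub _ (by omega), hsum, hsum, hf, zero_sub, norm_neg]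
    · rw [max_eq_right h1, ← pow_succ']
      rw [Finset.mem_Ico] at hj
      exact pow_le_pow_right₀ h1 (by omega)

/-- If few of the differences of consecutive coefficients of `P` are large in comparison with the
largest term of `P` on the circle through `w`, then `P` is not too small at one of the sample points:
up to a small error, `(1 - z) P` has few terms there. -/
theorem exists_large_value_of_few_differences {n : ℕ} (f : ℕ → ℂ) (hf : f (n + 1) = 0) (w : ℂ)
    (hw : w ≠ 0) {β : ℝ} (hβ : 0 < β) (hβ1 : β * (n + 1 : ℕ) ≤ 1) {m T : ℕ} (hT : 2 * m + 2 ≤ T)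
    (k₀ : ℕ) (hk₀ : k₀ ≤ n) (hfk₀ : f k₀ ≠ 0)
    (hfew : ((Finset.Icc 1 n).filter fun k =>
      (β / 4) ^ T / (2 * (n + 1) ^ 2) * (‖f k₀‖ * ‖w‖ ^ k₀) ≤ ‖f k - f (k - 1)‖ * ‖w‖ ^ k).card
        ≤ 2 * m) :
    ∃ t < T, (β / 4) ^ T / (4 * (n + 1)) * (‖f k₀‖ * ‖w‖ ^ k₀)
      ≤ ‖∑ k ∈ Finset.range (n + 1), f k * rotPoint w β t ^ k‖ := by
  set r := ‖w‖ with hr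
  have hr0 : 0 < r := norm_pos_iff.2 hw
  set κ := (β / 4) ^ T with hκ
  have hκ0 : 0 < κ := by positivity
  set M := ‖f k₀‖ * r ^ k₀ with hM
  have hM0 : 0 < M := by have := norm_pos_iff.2 hfk₀; positivity
  have hmax1 : 1 ≤ max 1 r := le_max_left _ _
  have hmax0 : 0 < max 1 r := by linarith
  have hβ1' : β ≤ 1 := by
    refine le_trans ?_ hβ1
    have : (1 : ℝ) ≤ ((n + 1 : ℕ) : ℝ) := by push_cast; linarith [Nat.cast_nonneg (α := ℝ) n]
    nlinarith
  have hκ1 : κ ≤ 1 := pow_le_one₀ (by positivity) (by linarith)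
  have hn1 : (1 : ℝ) ≤ n + 1 := by linarith [Nat.cast_nonneg (α := ℝ) n]
  set q : ℕ → ℂ := fun k => f k - if k = 0 then 0 else f (k - 1) with hqdef
  have hq0 : q 0 = f 0 := by simp [hqdef]
  have hq : ∀ k, q (k + 1) = f (k + 1) - f k := by intro k; simp [hqdef]
  have hQ : ∀ z : ℂ, ∑ k ∈ Finset.range (n + 2), q k * z ^ k
      = (1 - z) * ∑ k ∈ Finset.range (n + 1), f k * z ^ k := by
    intro z
    rw [Finset.sum_range_succ', hq0]
    simp only [hq, sub_mul]
    rw [Finset.sum_sub_distrib, one_mul, Finset.mul_sum]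
    have h1 := Finset.sum_range_succ' (fun k => f k * z ^ k) (n + 1)
    rw [Finset.sum_range_succ, hf, zero_mul, add_zero] at h1
    rw [h1]
    have h2 : ∑ k ∈ Finset.range (n + 1), f k * z ^ (k + 1)
        = ∑ k ∈ Finset.range (n + 1), z * (f k * z ^ k) :=
      Finset.sum_congr rfl fun k _ => by ring
    rw [h2]; ring
  obtain ⟨j, hj, hjM⟩ := exists_large_coeff_one_sub_mul f q hf hq0 hq hr0 k₀ hk₀
  rw [← hM] at hjM
  set τ := κ / (2 * ((n : ℝ) + 1) ^ 2) with hτ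
  have hτ0 : 0 < τ := by positivity
  set K : Finset ℕ := (Finset.range (n + 2)).filter
    fun k => k = 0 ∨ k = n + 1 ∨ τ * (max 1 r * M) ≤ ‖q k‖ * r ^ k with hK
  have hKcard : K.card ≤ T := by
    have hsub : K ⊆ insert 0 (insert (n + 1) ((Finset.Icc 1 n).filter fun k =>
        τ * M ≤ ‖f k - f (k - 1)‖ * r ^ k)) := by
      intro k hk
      simp only [hK, Finset.mem_filter, Finset.mem_range] at hk
      simp only [Finset.mem_insert, Finset.mem_filter, Finset.mem_Icc]
      obtain ⟨hk1, hk2⟩ := hk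
      by_cases h0 : k = 0
      · exact Or.inl h0
      by_cases h1 : k = n + 1
      · exact Or.inr (Or.inl h1)
      refine Or.inr (Or.inr ⟨⟨by omega, by omega⟩, ?_⟩)
      have h2 : τ * (max 1 r * M) ≤ ‖q k‖ * r ^ k := by tauto
      simp only [hqdef, h0, if_false] at h2
      refine le_trans ?_ h2
      have : M ≤ max 1 r * M := by nlinarith
      gcongr
    have h1 := Finset.card_le_card hsub
    have h2 := Finset.card_insert_le 0 (insert (n + 1) ((Finset.Icc 1 n).filter fun k =>
        τ * M ≤ ‖f k - f (k - 1)‖ * r ^ k))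
    have h3 := Finset.card_insert_le (n + 1) ((Finset.Icc 1 n).filter fun k =>
        τ * M ≤ ‖f k - f (k - 1)‖ * r ^ k)
    omega
  have hτ1 : τ * ((n : ℝ) + 1) ^ 2 = κ / 2 := by rw [hτ]; field_simp
  have hjK : j ∈ K := by
    simp only [hK, Finset.mem_filter, Finset.mem_range]
    refine ⟨by omega, Or.inr (Or.inr ?_)⟩
    have h1 : τ * ((n : ℝ) + 1) ≤ 1 := by nlinarith
    have h2 : ((n : ℝ) + 1) * (τ * (max 1 r * M)) ≤ (n + 1) * (‖q j‖ * r ^ j) := by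
      refine le_trans ?_ hjM
      have : 0 < max 1 r * M := by positivity
      nlinarith
    exact le_of_mul_le_mul_left h2 (by linarith)
  by_contra! hcon
  have hrest : ∀ t, ‖∑ k ∈ (Finset.range (n + 2)).filter (· ∉ K), q k * rotPoint w β t ^ k‖
      ≤ n * (τ * (max 1 r * M)) := by
    intro t
    calc _ ≤ ∑ k ∈ (Finset.range (n + 2)).filter (· ∉ K), ‖q k * rotPoint w β t ^ k‖ :=
          norm_sum_le _ _
      _ ≤ ∑ k ∈ (Finset.range (n + 2)).filter (· ∉ K), τ * (max 1 r * M) := by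
          refine Finset.sum_le_sum fun k hk => ?_
          simp only [hK, Finset.mem_filter, Finset.mem_range, not_and, not_or, not_le] at hk
          rw [norm_mul, norm_pow, norm_rotPoint]
          exact (hk.2 hk.1).2.2.le
      _ ≤ n * (τ * (max 1 r * M)) := by
          rw [Finset.sum_const, nsmul_eq_mul]
          have hsub : (Finset.range (n + 2)).filter (· ∉ K) ⊆ Finset.Icc 1 n := by
            intro k hk
            simp only [hK, Finset.mem_filter, Finset.mem_range, not_and, not_or] at hk
            have := hk.2 hk.1
            rw [Finset.mem_Icc]; omega
          have := Finset.card_le_card hsub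
          rw [Nat.card_Icc, Nat.add_sub_cancel] at this
          have h' : (((Finset.range (n + 2)).filter (· ∉ K)).card : ℝ) ≤ n := by exact_mod_cast this
          gcongr
  set A := (2 * max 1 r) * (κ / (4 * ((n : ℝ) + 1)) * M) + n * (τ * (max 1 r * M)) with hA
  have hlt : A < κ / (n + 1) * (max 1 r * M) := by
    have h1 : (n : ℝ) * τ < κ / (2 * (n + 1)) := by
      rw [lt_div_iff₀ (by positivity)]
      nlinarith
    have h2 : 0 < max 1 r * M := by positivity
    have h3 : A = (κ / (2 * (n + 1)) + n * τ) * (max 1 r * M) := by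
      rw [hA]; field_simp; ring
    rw [h3]
    refine mul_lt_mul_of_pos_right ?_ h2
    have : κ / ((n : ℝ) + 1) = κ / (2 * (n + 1)) + κ / (2 * (n + 1)) := by field_simp; ring
    linarith
  have := turan_sample K q w hβ hβ1 hβ1' (N := n + 1) (T := T) (by
      intro k hk
      simp only [hK, Finset.mem_filter, Finset.mem_range] at hk
      omega) hKcard A (by positivity) (by
      intro t ht
      have hsplit : ∑ k ∈ K, q k * rotPoint w β t ^ k
          = (∑ k ∈ Finset.range (n + 2), q k * rotPoint w β t ^ k)
            - ∑ k ∈ (Finset.range (n + 2)).filter (· ∉ K), q k * rotPoint w β t ^ k := by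
        rw [← Finset.sum_filter_add_sum_filter_not (Finset.range (n + 2)) (· ∈ K), add_sub_cancel_right]
        refine Finset.sum_congr ?_ fun _ _ => rfl
        ext k
        simp only [hK, Finset.mem_filter]
        tauto
      rw [hsplit]
      refine (norm_sub_le _ _).trans (add_le_add ?_ (hrest t))
      rw [hQ, norm_mul]
      refine mul_le_mul ?_ (hcon t ht).le (norm_nonneg _) (by positivity)
      refine (norm_sub_le _ _).trans ?_
      rw [norm_one, norm_rotPoint]
      have := le_max_right 1 r
      linarith) j hjK
  have h2 : κ / (n + 1) * (max 1 r * M) ≤ κ * (‖q j‖ * r ^ j) := by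
    rw [div_mul_eq_mul_div, div_le_iff₀ (by positivity)]
    calc κ * (max 1 r * M) ≤ κ * ((n + 1) * (‖q j‖ * r ^ j)) := by gcongr
      _ = _ := by ring
  linarith

/-! ### Interchanging neighbouring coefficients -/

theorem coeffPoly_coeff {n : ℕ} (a : Fin (n + 1) → ℂ) (k : ℕ) :
    (coeffPoly a).coeff k = if h : k < n + 1 then a ⟨k, h⟩ else 0 := by
  rw [coeffPoly, Polynomial.finsetSum_coeff]
  simp only [Polynomial.coeff_C_mul, Polynomial.coeff_X_pow, mul_ite, mul_one, mul_zero]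
  split_ifs with h
  · rw [Finset.sum_eq_single ⟨k, h⟩]
    · simp
    · intro b _ hb
      rw [if_neg]
      rintro rfl
      exact hb rfl
    · simp
  · refine Finset.sum_eq_zero fun b _ => ?_
    rw [if_neg]
    have := b.2
    omega

theorem coeffPoly_coeff_fin {n : ℕ} (a : Fin (n + 1) → ℂ) (k : Fin (n + 1)) :
    (coeffPoly a).coeff k = a k := by
  rw [coeffPoly_coeff, dif_pos k.2]

theorem coeffPoly_eval {n : ℕ} (a : Fin (n + 1) → ℂ) (z : ℂ) :
    (coeffPoly a).eval z = ∑ k : Fin (n + 1), a k * z ^ (k : ℕ) := by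
  simp [coeffPoly, Polynomial.eval_finsetSum]

theorem coeffPoly_eval_range {n : ℕ} (a : Fin (n + 1) → ℂ) (z : ℂ) :
    (coeffPoly a).eval z = ∑ k ∈ Finset.range (n + 1), (coeffPoly a).coeff k * z ^ k := by
  rw [coeffPoly_eval, ← Fin.sum_univ_eq_sum_range (fun k => (coeffPoly a).coeff k * z ^ k)]
  simp only [coeffPoly_coeff_fin]

/-- The largest term `max_k |a_k| r ^ k` of a polynomial on the circle of radius `r`. -/
noncomputable def maxTerm {n : ℕ} (a : Fin (n + 1) → ℂ) (r : ℝ) : ℝ :=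
  Finset.univ.sup' Finset.univ_nonempty fun k : Fin (n + 1) => ‖a k‖ * r ^ (k : ℕ)

theorem le_maxTerm {n : ℕ} (a : Fin (n + 1) → ℂ) (r : ℝ) (k : Fin (n + 1)) :
    ‖a k‖ * r ^ (k : ℕ) ≤ maxTerm a r :=
  Finset.le_sup' (fun k : Fin (n + 1) => ‖a k‖ * r ^ (k : ℕ)) (Finset.mem_univ k)

theorem exists_eq_maxTerm {n : ℕ} (a : Fin (n + 1) → ℂ) (r : ℝ) :
    ∃ k : Fin (n + 1), maxTerm a r = ‖a k‖ * r ^ (k : ℕ) := by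
  obtain ⟨k, -, hk⟩ := Finset.exists_mem_eq_sup' Finset.univ_nonempty
    fun k : Fin (n + 1) => ‖a k‖ * r ^ (k : ℕ)
  exact ⟨k, hk⟩

theorem maxTerm_pos {n : ℕ} {a : Fin (n + 1) → ℂ} (ha : ∀ k, a k ≠ 0) {r : ℝ} (hr : 0 < r) :
    0 < maxTerm a r := by
  refine lt_of_lt_of_le ?_ (le_maxTerm a r 0)
  have := norm_pos_iff.2 (ha 0)
  positivity

/-- All values of the polynomial at the first `T` sample points are less than `τ` times its largest
term on the circle through these points. -/
def IsSmallAt {n : ℕ} (w : ℂ) (β : ℝ) (T : ℕ) (τ : ℝ) (a : Fin (n + 1) → ℂ) : Prop :=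
  ∀ t < T, ‖(coeffPoly a).eval (rotPoint w β t)‖ < τ * maxTerm a ‖w‖

/-- The numbers `k ∈ [1, n]` of parity `p`; such a `k` stands for the pair of indices `{k - 1, k}`.
These pairs are disjoint. -/
def pairs (n p : ℕ) : Finset ℕ := (Finset.Icc 1 n).filter fun k => k % 2 = p

/-- For a set `U` of numbers of the same parity in `[1, n]`, the map that interchanges `k - 1` and `k`
for all `k ∈ U`. -/
def flipPairs (U : Finset ℕ) {n : ℕ} (k : Fin (n + 1)) : Fin (n + 1) :=
  if (k : ℕ) ∈ U then ⟨k - 1, by omega⟩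
  else if h : (k : ℕ) + 1 ∈ U ∧ (k : ℕ) + 1 < n + 1 then ⟨k + 1, h.2⟩ else k

theorem mod_two_of_mem {n p : ℕ} {U : Finset ℕ} (hU : U ⊆ pairs n p) {k : ℕ} (hk : k ∈ U) :
    1 ≤ k ∧ k ≤ n ∧ k % 2 = p := by
  have := hU hk
  rw [pairs, Finset.mem_filter, Finset.mem_Icc] at this
  tauto

theorem flipPairs_val {n p : ℕ} {U : Finset ℕ} (hU : U ⊆ pairs n p) (k : Fin (n + 1)) :
    (flipPairs U k : ℕ) = if (k : ℕ) ∈ U then (k : ℕ) - 1 else if (k : ℕ) + 1 ∈ U then (k : ℕ) + 1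
      else k := by
  rw [flipPairs]
  by_cases h1 : (k : ℕ) ∈ U
  · simp [h1]
  by_cases h2 : (k : ℕ) + 1 ∈ U
  · have := mod_two_of_mem hU h2
    have h3 : (k : ℕ) + 1 < n + 1 := by omega
    simp only [h1, h2, h3, if_false, and_self, dite_true, if_true]
  · simp [h1, h2]

theorem flipPairs_involutive {n p : ℕ} {U : Finset ℕ} (hU : U ⊆ pairs n p) :
    Function.Involutive (flipPairs U : Fin (n + 1) → Fin (n + 1)) := by
  intro k
  apply Fin.ext
  rw [flipPairs_val hU, flipPairs_val hU]
  by_cases h1 : (k : ℕ) ∈ U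
  · have a1 := mod_two_of_mem hU h1
    have h2 : (k : ℕ) - 1 ∉ U := fun h => by have := mod_two_of_mem hU h; omega
    have h3 : (k : ℕ) - 1 + 1 = k := by omega
    simp [h1, h2, h3]
  by_cases h2 : (k : ℕ) + 1 ∈ U
  · simp [h1, h2]
  · simp [h1, h2]

theorem coeffPoly_flip_coeff {n p : ℕ} {U : Finset ℕ} (hU : U ⊆ pairs n p) (b : Fin (n + 1) → ℂ)
    (k : ℕ) : (coeffPoly (b ∘ flipPairs U)).coeff k = if k ∈ U then (coeffPoly b).coeff (k - 1)
      else if k + 1 ∈ U then (coeffPoly b).coeff (k + 1) else (coeffPoly b).coeff k := by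
  by_cases hk : k < n + 1
  · have h := flipPairs_val hU ⟨k, hk⟩
    rw [coeffPoly_coeff, dif_pos hk, Function.comp_apply, ← coeffPoly_coeff_fin b, h]
    split_ifs <;> rfl
  · have h1 : k ∉ U := fun h => by have := mod_two_of_mem hU h; omega
    have h2 : k + 1 ∉ U := fun h => by have := mod_two_of_mem hU h; omega
    simp [h1, h2, coeffPoly_coeff, hk]

theorem norm_coeff_sub_flip {n p : ℕ} {U : Finset ℕ} (hU : U ⊆ pairs n p) (b : Fin (n + 1) → ℂ)
    {k : ℕ} (hk : k ∈ pairs n p) :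
    ‖(coeffPoly (b ∘ flipPairs U)).coeff k - (coeffPoly (b ∘ flipPairs U)).coeff (k - 1)‖
      = ‖(coeffPoly b).coeff k - (coeffPoly b).coeff (k - 1)‖ := by
  have a1 := mod_two_of_mem subset_rfl hk
  have h2 : k - 1 ∉ U := fun h => by have := mod_two_of_mem hU h; omega
  have h4 : k + 1 ∉ U := fun h => by have := mod_two_of_mem hU h; omega
  have h3 : k - 1 + 1 = k := by omega
  rw [coeffPoly_flip_coeff hU, coeffPoly_flip_coeff hU]
  by_cases h1 : k ∈ U
  · simp only [h1, h2, h3, if_true, if_false]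
    rw [norm_sub_rev]
  · simp [h1, h2, h3, h4]

/-- The pairs of parity `p` whose two coefficients differ by at least `σ` times the largest term. -/
noncomputable def largePairs {n : ℕ} (p : ℕ) (r σ : ℝ) (b : Fin (n + 1) → ℂ) : Finset ℕ :=
  (pairs n p).filter fun k =>
    σ * maxTerm b r ≤ ‖(coeffPoly b).coeff k - (coeffPoly b).coeff (k - 1)‖ * r ^ k

open Classical in
/-- Anti-concentration with respect to flips of pairs. Among the small polynomials obtained by flips
and having `m` pairs with large differences, compare all with one with maximal largest term. Two of
them that agree off `m` of its large pairs differ by a polynomial with at most `2 m` terms, one of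
which is large, and Turán's lemma says that they cannot both be small. -/
theorem card_flips_small_le {n : ℕ} (p : ℕ) (b : Fin (n + 1) → ℂ) (hb : ∀ k, b k ≠ 0) (w : ℂ)
    (hw : w ≠ 0) {β : ℝ} (hβ : 0 < β) (hβ1 : β * (n + 1 : ℕ) ≤ 1) {m T : ℕ} (hT : 2 * m ≤ T)
    {σ : ℝ} (hσ : 0 < σ) :
    ((pairs n p).powerset.filter fun U => IsSmallAt w β T ((β / 4) ^ T * σ / 4) (b ∘ flipPairs U) ∧
      m ≤ (largePairs p ‖w‖ σ (b ∘ flipPairs U)).card).card * 2 ^ m ≤ 2 ^ (pairs n p).card := by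
  set S := (pairs n p).powerset.filter fun U => IsSmallAt w β T ((β / 4) ^ T * σ / 4) (b ∘ flipPairs U) ∧
      m ≤ (largePairs p ‖w‖ σ (b ∘ flipPairs U)).card with hS
  rcases S.eq_empty_or_nonempty with h0 | hne
  · simp [h0]
  have hβ1' : β ≤ 1 := by
    refine le_trans ?_ hβ1
    have : (1 : ℝ) ≤ ((n + 1 : ℕ) : ℝ) := by push_cast; linarith [Nat.cast_nonneg (α := ℝ) n]
    nlinarith
  obtain ⟨V, hV, hVmax⟩ := Finset.exists_max_image S (fun U => maxTerm (b ∘ flipPairs U) ‖w‖) hne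
  have hV' := hV
  simp only [hS, Finset.mem_filter, Finset.mem_powerset] at hV'
  obtain ⟨hVp, -, hVm⟩ := hV'
  obtain ⟨K, hKsub, hKcard⟩ := Finset.exists_subset_card_eq hVm
  have hKp : K ⊆ pairs n p := hKsub.trans (Finset.filter_subset _ _)
  set M := maxTerm (b ∘ flipPairs V) ‖w‖ with hM
  have hM0 : 0 < M := maxTerm_pos (fun k => hb _) (norm_pos_iff.2 hw)
  have hKlarge : ∀ k ∈ K, σ * M ≤
      ‖(coeffPoly b).coeff k - (coeffPoly b).coeff (k - 1)‖ * ‖w‖ ^ k := by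
    intro k hk
    have := hKsub hk
    rw [largePairs, Finset.mem_filter, norm_coeff_sub_flip hVp b this.1] at this
    exact this.2
  have hinj : Set.InjOn (fun U => U \ K) (S : Set (Finset ℕ)) := by
    intro U hU U' hU' heq
    simp only at heq
    by_contra hne'
    have hUM := hVmax U hU
    have hUM' := hVmax U' hU'
    simp only [hS, Finset.coe_filter, Finset.mem_powerset, Set.mem_ofPred_eq] at hU hU'
    have hiff : ∀ k ∉ K, (k ∈ U ↔ k ∈ U') := by
      intro k hk
      have := Finset.ext_iff.1 heq k
      simpa [hk] using this
    obtain ⟨k₀, hk₀⟩ : ∃ k, ¬ (k ∈ U ↔ k ∈ U') := by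
      by_contra! h
      exact hne' (Finset.ext h)
    have hk₀K : k₀ ∈ K := by
      by_contra h
      exact hk₀ (hiff _ h)
    set d : ℕ → ℂ := fun k => (coeffPoly (b ∘ flipPairs U)).coeff k - (coeffPoly (b ∘ flipPairs U')).coeff k
      with hd
    have hdzero : ∀ k, k ∉ K → k + 1 ∉ K → d k = 0 := by
      intro k h1 h2
      simp only [hd, coeffPoly_flip_coeff hU.1, coeffPoly_flip_coeff hU'.1, hiff _ h1, hiff _ h2,
        sub_self]
    have hdk₀ : ‖d k₀‖ = ‖(coeffPoly b).coeff k₀ - (coeffPoly b).coeff (k₀ - 1)‖ := by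
      have hpar := mod_two_of_mem hKp hk₀K
      have h1 : k₀ + 1 ∉ U := fun h => by have := mod_two_of_mem hU.1 h; omega
      have h2 : k₀ + 1 ∉ U' := fun h => by have := mod_two_of_mem hU'.1 h; omega
      simp only [hd, coeffPoly_flip_coeff hU.1, coeffPoly_flip_coeff hU'.1]
      by_cases h3 : k₀ ∈ U
      · have h4 : k₀ ∉ U' := by tauto
        simp only [h3, h4, h2, if_true, if_false]
        rw [norm_sub_rev]
      · have h4 : k₀ ∈ U' := by tauto
        simp only [h3, h4, h1, if_true, if_false]
    set K₂ := (K ∪ K.image fun k => k - 1) with hK₂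
    have hK₂card : K₂.card ≤ T := by
      have h1 := Finset.card_union_le K (K.image fun k => k - 1)
      have h2 : (K.image fun k => k - 1).card ≤ K.card := Finset.card_image_le
      rw [← hK₂] at h1
      omega
    have hK₂n : ∀ k ∈ K₂, k ≤ n := by
      intro k hk
      rw [hK₂, Finset.mem_union, Finset.mem_image] at hk
      rcases hk with hk | ⟨j, hj, rfl⟩
      · exact (mod_two_of_mem hKp hk).2.1
      · have := (mod_two_of_mem hKp hj).2.1
        omega
    have hsum : ∀ z : ℂ, ∑ k ∈ K₂, d k * z ^ k
        = (coeffPoly (b ∘ flipPairs U)).eval z - (coeffPoly (b ∘ flipPairs U')).eval z := by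
      intro z
      rw [coeffPoly_eval_range, coeffPoly_eval_range, ← Finset.sum_sub_distrib]
      simp only [← sub_mul]
      refine Finset.sum_subset (fun k hk => ?_) (fun k _ hk => ?_)
      · have := hK₂n k hk
        rw [Finset.mem_range]; omega
      · rw [hK₂, Finset.mem_union, Finset.mem_image, not_or] at hk
        have : d k = 0 := hdzero k hk.1 fun h => hk.2 ⟨k + 1, h, by simp⟩
        change d k * z ^ k = 0
        rw [this, zero_mul]
    set κ := (β / 4) ^ T with hκ
    have hκ0 : 0 < κ := by positivity
    have := turan_sample K₂ d w hβ (N := n + 1) hβ1 hβ1' (fun k hk => (hK₂n k hk).trans (by omega))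
      hK₂card (κ * σ / 4 * M + κ * σ / 4 * M) (by positivity) (by
        intro t ht
        rw [hsum]
        refine (norm_sub_le _ _).trans (add_le_add ?_ ?_)
        · exact (hU.2.1 t ht).le.trans (by gcongr)
        · exact (hU'.2.1 t ht).le.trans (by gcongr)) k₀ (by
        rw [hK₂]; exact Finset.mem_union_left _ hk₀K)
    rw [hdk₀] at this
    have h1 : κ * (σ * M) ≤ _ := mul_le_mul_of_nonneg_left (hKlarge k₀ hk₀K) hκ0.le
    have h2 : 0 < κ * (σ * M) := by positivity
    nlinarith
  have hcard : S.card ≤ ((pairs n p) \ K).powerset.card := by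
    refine Finset.card_le_card_of_injOn (fun U => U \ K) (fun U hU => ?_) hinj
    simp only [hS, Finset.coe_filter, Finset.mem_powerset, Set.mem_ofPred_eq] at hU
    simp only [Finset.mem_coe, Finset.mem_powerset]
    exact Finset.sdiff_subset_sdiff hU.1 subset_rfl
  rw [Finset.card_powerset, Finset.card_sdiff_of_subset hKp, hKcard] at hcard
  have hmP : m ≤ (pairs n p).card := hKcard ▸ Finset.card_le_card hKp
  calc S.card * 2 ^ m ≤ 2 ^ ((pairs n p).card - m) * 2 ^ m := Nat.mul_le_mul_right _ hcard
    _ = 2 ^ (pairs n p).card := by rw [← pow_add, Nat.sub_add_cancel hmP]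

open Classical in
/-- If a property holds for at most a fraction `1 / 2 ^ m` of the flips of each arrangement, then it
holds for at most that fraction of all arrangements. -/
theorem card_perms_mul_le_of_flips {n : ℕ} (p m : ℕ) (a : Fin (n + 1) → ℂ)
    (Bad : (Fin (n + 1) → ℂ) → Prop)
    (h : ∀ π : Equiv.Perm (Fin (n + 1)),
      ((pairs n p).powerset.filter fun U => Bad ((a ∘ π) ∘ flipPairs U)).card * 2 ^ m
        ≤ 2 ^ (pairs n p).card) :
    (Finset.univ.filter fun π : Equiv.Perm (Fin (n + 1)) => Bad (a ∘ π)).card * 2 ^ m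
      ≤ (n + 1).factorial := by
  have hflip : ∀ U ∈ (pairs n p).powerset,
      (Finset.univ.filter fun π : Equiv.Perm (Fin (n + 1)) => Bad ((a ∘ π) ∘ flipPairs U)).card
        = (Finset.univ.filter fun π : Equiv.Perm (Fin (n + 1)) => Bad (a ∘ π)).card := by
    intro U hU
    set σ : Equiv.Perm (Fin (n + 1)) :=
      (flipPairs_involutive (n := n) (Finset.mem_powerset.1 hU)).toPerm with hσ
    rw [Finset.card_filter, Finset.card_filter]
    exact Fintype.sum_equiv (Equiv.mulRight σ) _ _ fun π => rfl
  have hdouble : (Finset.univ.filter fun π : Equiv.Perm (Fin (n + 1)) => Bad (a ∘ π)).card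
      * 2 ^ (pairs n p).card
      = ∑ π : Equiv.Perm (Fin (n + 1)),
        ((pairs n p).powerset.filter fun U => Bad ((a ∘ π) ∘ flipPairs U)).card := by
    simp only [Finset.card_filter]
    rw [Finset.sum_comm]
    simp only [← Finset.card_filter]
    rw [Finset.sum_congr rfl hflip, Finset.sum_const, Finset.card_powerset, smul_eq_mul, mul_comm]
  refine Nat.le_of_mul_le_mul_right (c := 2 ^ (pairs n p).card) ?_ (by positivity)
  calc _ = (∑ π : Equiv.Perm (Fin (n + 1)),
        ((pairs n p).powerset.filter fun U => Bad ((a ∘ π) ∘ flipPairs U)).card) * 2 ^ m := by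
        rw [← hdouble]; ring
    _ ≤ ∑ _π : Equiv.Perm (Fin (n + 1)), 2 ^ (pairs n p).card := by
        rw [Finset.sum_mul]
        exact Finset.sum_le_sum fun π _ => h π
    _ = _ := by
        rw [Finset.sum_const, Finset.card_univ, Fintype.card_perm, Fintype.card_fin, smul_eq_mul]

/-- The factor by which values of a polynomial at the sample points are allowed to fall short of its
largest term. -/
noncomputable def smallFactor (n : ℕ) (β : ℝ) (T : ℕ) : ℝ :=
  (β / 4) ^ T * ((β / 4) ^ T / (2 * (n + 1) ^ 2)) / 4

theorem smallFactor_pos (n : ℕ) {β : ℝ} (hβ : 0 < β) (T : ℕ) : 0 < smallFactor n β T := by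
  rw [smallFactor]; positivity

/-- A small polynomial has many large differences of consecutive coefficients, and half of them have
the same parity. -/
theorem IsSmallAt.exists_parity {n : ℕ} {a : Fin (n + 1) → ℂ} (ha : ∀ k, a k ≠ 0) {w : ℂ}
    (hw : w ≠ 0) {β : ℝ} (hβ : 0 < β) (hβ1 : β * (n + 1 : ℕ) ≤ 1) {m T : ℕ} (hT : 2 * m + 2 ≤ T)
    (h : IsSmallAt w β T (smallFactor n β T) a) :
    m ≤ (largePairs 0 ‖w‖ ((β / 4) ^ T / (2 * (n + 1) ^ 2)) a).card ∨
    m ≤ (largePairs 1 ‖w‖ ((β / 4) ^ T / (2 * (n + 1) ^ 2)) a).card := by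
  by_contra! hcon
  obtain ⟨k₀, hk₀⟩ := exists_eq_maxTerm a ‖w‖
  have hc := coeffPoly_coeff_fin a k₀
  obtain ⟨t, ht, hle⟩ := exists_large_value_of_few_differences (n := n) (coeffPoly a).coeff
    (by simp [coeffPoly_coeff]) w hw hβ hβ1 hT k₀ (by omega) (by rw [hc]; exact ha k₀) (by
      rw [hc, ← hk₀]
      refine le_trans (Finset.card_le_card (t := largePairs 0 ‖w‖ ((β / 4) ^ T / (2 * (n + 1) ^ 2)) a
        ∪ largePairs 1 ‖w‖ ((β / 4) ^ T / (2 * (n + 1) ^ 2)) a) ?_)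
        ((Finset.card_union_le _ _).trans (by omega))
      intro k hk
      simp only [largePairs, pairs, Finset.mem_union, Finset.mem_filter] at hk ⊢
      rcases Nat.mod_two_eq_zero_or_one k with h0 | h1
      · exact Or.inl ⟨⟨hk.1, h0⟩, hk.2⟩
      · exact Or.inr ⟨⟨hk.1, h1⟩, hk.2⟩)
  rw [hc, ← hk₀, ← coeffPoly_eval_range] at hle
  have h1 := h t ht
  have hM := maxTerm_pos ha (norm_pos_iff.2 hw)
  have hκ0 : 0 < (β / 4) ^ T := by positivity
  have hβ1' : β ≤ 1 := by
    refine le_trans ?_ hβ1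
    have : (1 : ℝ) ≤ ((n + 1 : ℕ) : ℝ) := by push_cast; linarith [Nat.cast_nonneg (α := ℝ) n]
    nlinarith
  have hκ1 : (β / 4) ^ T ≤ 1 := pow_le_one₀ (by positivity) (by linarith)
  have hn1 : (1 : ℝ) ≤ n + 1 := by linarith [Nat.cast_nonneg (α := ℝ) n]
  have h2 : smallFactor n β T ≤ (β / 4) ^ T / (4 * (n + 1)) := by
    rw [smallFactor, mul_div_assoc, div_eq_mul_inv _ (4 * ((n : ℝ) + 1))]
    refine mul_le_mul_of_nonneg_left ?_ hκ0.le
    rw [div_div, div_le_iff₀ (by positivity)]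
    have : (4 * ((n : ℝ) + 1))⁻¹ * (2 * (n + 1) ^ 2 * 4) = 2 * (n + 1) := by field_simp
    rw [this]
    linarith
  have h3 := mul_le_mul_of_nonneg_right h2 hM.le
  linarith

open Classical in
/-- For given nonzero values `a_k`, the polynomials with randomly permuted coefficients are small at
the sample points with probability at most `2 ^ (1 - m)`. -/
theorem card_perms_small_le {n : ℕ} (a : Fin (n + 1) → ℂ) (ha : ∀ k, a k ≠ 0) (w : ℂ)
    (hw : w ≠ 0) {β : ℝ} (hβ : 0 < β) (hβ1 : β * (n + 1 : ℕ) ≤ 1) {m T : ℕ} (hT : 2 * m + 2 ≤ T) :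
    (Finset.univ.filter fun π : Equiv.Perm (Fin (n + 1)) =>
      IsSmallAt w β T (smallFactor n β T) (a ∘ π)).card * 2 ^ m ≤ 2 * (n + 1).factorial := by
  set σ := (β / 4) ^ T / (2 * ((n : ℝ) + 1) ^ 2) with hσ
  have hσ0 : 0 < σ := by positivity
  have key : ∀ p, (Finset.univ.filter fun π : Equiv.Perm (Fin (n + 1)) =>
      IsSmallAt w β T (smallFactor n β T) (a ∘ π) ∧
        m ≤ (largePairs p ‖w‖ σ (a ∘ π)).card).card * 2 ^ m ≤ (n + 1).factorial := by
    intro p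
    have h := card_perms_mul_le_of_flips p m a (fun b => IsSmallAt w β T (smallFactor n β T) b ∧
      m ≤ (largePairs p ‖w‖ σ b).card) fun π => by
        have h := card_flips_small_le p (a ∘ π) (fun k => ha _) w hw hβ hβ1 (m := m) (T := T)
          (by omega) hσ0
        convert h
        rfl
    convert h
  have h0 := key 0
  have h1 := key 1
  have hsub : (Finset.univ.filter fun π : Equiv.Perm (Fin (n + 1)) =>
      IsSmallAt w β T (smallFactor n β T) (a ∘ π)) ⊆
      (Finset.univ.filter fun π : Equiv.Perm (Fin (n + 1)) =>
        IsSmallAt w β T (smallFactor n β T) (a ∘ π) ∧ m ≤ (largePairs 0 ‖w‖ σ (a ∘ π)).card) ∪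
      (Finset.univ.filter fun π : Equiv.Perm (Fin (n + 1)) =>
        IsSmallAt w β T (smallFactor n β T) (a ∘ π) ∧ m ≤ (largePairs 1 ‖w‖ σ (a ∘ π)).card) := by
    intro π hπ
    simp only [Finset.mem_filter, Finset.mem_union, Finset.mem_univ, true_and] at hπ ⊢
    rcases hπ.exists_parity (fun k => ha _) hw hβ hβ1 hT with h | h
    · exact Or.inl ⟨hπ, h⟩
    · exact Or.inr ⟨hπ, h⟩
  have h2 := (Finset.card_le_card hsub).trans (Finset.card_union_le _ _)
  have h3 := Nat.mul_le_mul_right (2 ^ m) h2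
  rw [add_mul] at h3
  omega

/-! ### Critical points and records -/

/-- The `k`-th of the lines `s ↦ y_k + k s`. For `y_k = log |a_k|` it is the logarithm of the `k`-th
term of the polynomial on the circle of radius `exp s`. -/
def line {n : ℕ} (y : Fin (n + 1) → ℝ) (k : Fin (n + 1)) (s : ℝ) : ℝ := y k + k * s

/-- The `k`-th line is among the highest ones at `s`. -/
def IsHighest {n : ℕ} (y : Fin (n + 1) → ℝ) (s : ℝ) (k : Fin (n + 1)) : Prop :=
  ∀ j, line y j s ≤ line y k s

theorem exists_isHighest {n : ℕ} (y : Fin (n + 1) → ℝ) (s : ℝ) : ∃ k, IsHighest y s k := by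
  obtain ⟨k, hk⟩ := Finite.exists_max fun k => line y k s
  exact ⟨k, hk⟩

/-- A finite set that contains the abscissae of all intersections of the lines for all rearrangements
of the intercepts `y`. -/
noncomputable def slopeSet {n : ℕ} (y : Fin (n + 1) → ℝ) : Finset ℝ :=
  Finset.univ.image fun q : Fin (n + 1) × Fin (n + 1) × Fin (n + 1) => (y q.1 - y q.2.1) / q.2.2

theorem card_slopeSet_le {n : ℕ} (y : Fin (n + 1) → ℝ) : (slopeSet y).card ≤ (n + 1) ^ 3 := by
  refine Finset.card_image_le.trans (le_of_eq ?_)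
  simp only [Finset.card_univ, Fintype.card_prod, Fintype.card_fin]
  ring

theorem slopeSet_comp_perm {n : ℕ} (y : Fin (n + 1) → ℝ) (π : Equiv.Perm (Fin (n + 1))) :
    slopeSet (y ∘ π) ⊆ slopeSet y := by
  intro s hs
  simp only [slopeSet, Finset.mem_image, Finset.mem_univ, true_and, Prod.exists] at hs ⊢
  obtain ⟨p, q, d, rfl⟩ := hs
  exact ⟨π p, π q, d, rfl⟩

open Classical in
/-- The critical points: the break points of the upper envelope of the lines, that is, the slopes of
the Newton–Hadamard polygon. -/
noncomputable def crit {n : ℕ} (y : Fin (n + 1) → ℝ) : Finset ℝ :=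
  (slopeSet y).filter fun s => ∃ k l, k < l ∧ IsHighest y s k ∧ IsHighest y s l

theorem mem_crit {n : ℕ} {y : Fin (n + 1) → ℝ} {s : ℝ} :
    s ∈ crit y ↔ ∃ k l, k < l ∧ IsHighest y s k ∧ IsHighest y s l := by
  classical
  rw [crit, Finset.mem_filter, and_iff_right_iff_imp]
  rintro ⟨k, l, hkl, hk, hl⟩
  simp only [slopeSet, Finset.mem_image, Finset.mem_univ, true_and, Prod.exists]
  refine ⟨k, l, ⟨(l : ℕ) - k, by omega⟩, ?_⟩
  have h := le_antisymm (hk l) (hl k)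
  have hkl' : (k : ℕ) < l := hkl
  have hd : ((k : ℕ) : ℝ) < (l : ℕ) := by exact_mod_cast hkl'
  simp only [line] at h
  rw [Nat.cast_sub hkl'.le, div_eq_iff (by linarith)]
  linarith

theorem mem_crit_of_ne {n : ℕ} {y : Fin (n + 1) → ℝ} {s : ℝ} {k l : Fin (n + 1)} (h : k ≠ l)
    (hk : IsHighest y s k) (hl : IsHighest y s l) : s ∈ crit y := by
  rcases lt_or_gt_of_ne h with h | h
  · exact mem_crit.2 ⟨k, l, h, hk, hl⟩
  · exact mem_crit.2 ⟨l, k, h, hl, hk⟩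

theorem crit_subset_slopeSet {n : ℕ} (y : Fin (n + 1) → ℝ) : crit y ⊆ slopeSet y := by
  classical
  exact Finset.filter_subset _ _

/-- A line that is highest at `s` can be caught up to the right of `s` only across a critical point:
the first intersection with a steeper line is one. -/
theorem exists_crit_right {n : ℕ} {y : Fin (n + 1) → ℝ} {s s' : ℝ} {k j : Fin (n + 1)}
    (hk : IsHighest y s k) (hss : s ≤ s') (hjk : j ≠ k) (hj : line y k s' ≤ line y j s') :
    ∃ c ∈ crit y, s ≤ c ∧ c ≤ s' := by
  rcases lt_or_gt_of_ne hjk with hlt | hgt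
  · have hlt' : ((j : ℕ) : ℝ) < (k : ℕ) := by exact_mod_cast hlt
    have h1 := hk j
    simp only [line] at h1 hj
    have hs : s = s' := by nlinarith
    subst hs
    refine ⟨s, mem_crit_of_ne hjk (fun i => (hk i).trans ?_) hk, le_rfl, le_rfl⟩
    simp only [line]; linarith
  · obtain ⟨l, hl, hmin⟩ := Finset.exists_min_image (Finset.Ioi k)
      (fun l : Fin (n + 1) => (y k - y l) / ((l : ℕ) - (k : ℕ) : ℝ)) ⟨j, Finset.mem_Ioi.2 hgt⟩
    set c := (y k - y l) / ((l : ℕ) - (k : ℕ) : ℝ) with hc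
    have hpos : ∀ i : Fin (n + 1), k < i → (0 : ℝ) < (i : ℕ) - (k : ℕ) := by
      intro i hi
      have : ((k : ℕ) : ℝ) < (i : ℕ) := by exact_mod_cast hi
      linarith
    have hkl := Finset.mem_Ioi.1 hl
    have hsc : s ≤ c := by
      rw [hc, le_div_iff₀ (hpos l hkl)]
      have := hk l
      simp only [line] at this
      linarith
    have hcs : c ≤ s' := by
      refine (hmin j (Finset.mem_Ioi.2 hgt)).trans ?_
      rw [div_le_iff₀ (hpos j hgt)]
      simp only [line] at hj
      linarith
    have htop : IsHighest y c k := by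
      intro i
      rcases lt_trichotomy i k with hi | rfl | hi
      · have h1 := hk i
        have : ((i : ℕ) : ℝ) < (k : ℕ) := by exact_mod_cast hi
        simp only [line] at h1 ⊢
        nlinarith
      · exact le_rfl
      · have h1 := hmin i (Finset.mem_Ioi.2 hi)
        rw [le_div_iff₀ (hpos i hi)] at h1
        simp only [line]
        linarith
    have heq : line y l c = line y k c := by
      have : c * ((l : ℕ) - (k : ℕ) : ℝ) = y k - y l := div_mul_cancel₀ _ (hpos l hkl).ne'
      simp only [line]
      linarith
    exact ⟨c, mem_crit_of_ne hkl.ne htop fun i => (htop i).trans heq.ge, hsc, hcs⟩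

theorem line_rev {n : ℕ} (y : Fin (n + 1) → ℝ) (k : Fin (n + 1)) (s : ℝ) :
    line (y ∘ Fin.rev) k (-s) = line y k.rev s - n * s := by
  simp only [line, Function.comp_apply, Fin.val_rev]
  rw [Nat.cast_sub (by omega)]
  push_cast
  ring

theorem isHighest_rev {n : ℕ} {y : Fin (n + 1) → ℝ} {k : Fin (n + 1)} {s : ℝ} :
    IsHighest (y ∘ Fin.rev) (-s) k ↔ IsHighest y s k.rev := by
  simp only [IsHighest, line_rev, sub_le_sub_iff_right]
  refine ⟨fun h j => ?_, fun h j => h _⟩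
  have := h j.rev
  rwa [Fin.rev_rev] at this

theorem exists_crit_left {n : ℕ} {y : Fin (n + 1) → ℝ} {s s' : ℝ} {k j : Fin (n + 1)}
    (hk : IsHighest y s k) (hss : s' ≤ s) (hjk : j ≠ k) (hj : line y k s' ≤ line y j s') :
    ∃ c ∈ crit y, s' ≤ c ∧ c ≤ s := by
  obtain ⟨c, hc, h1, h2⟩ := exists_crit_right (y := y ∘ Fin.rev) (s := -s) (s' := -s') (k := k.rev)
    (j := j.rev) (isHighest_rev.2 (by rwa [Fin.rev_rev])) (by linarith)
    (fun h => hjk (Fin.rev_injective h))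
    (by rw [line_rev, line_rev, Fin.rev_rev, Fin.rev_rev]; linarith)
  obtain ⟨i, l, hil, hi, hl⟩ := mem_crit.1 hc
  rw [← neg_neg c, isHighest_rev] at hi hl
  exact ⟨-c, mem_crit_of_ne (fun h => hil.ne (Fin.rev_injective h)) hi hl, by linarith, by linarith⟩

open Classical in
/-- The positions of the strict records of a sequence. -/
noncomputable def leftRecords {n : ℕ} (y : Fin (n + 1) → ℝ) : Finset (Fin (n + 1)) :=
  Finset.univ.filter fun k => ∀ j ∈ Finset.Iic k, j ≠ k → y j < y k

open Classical in
/-- The positions of the strict records of a sequence that is read backwards. -/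
noncomputable def rightRecords {n : ℕ} (y : Fin (n + 1) → ℝ) : Finset (Fin (n + 1)) :=
  Finset.univ.filter fun k => ∀ j ∈ Finset.Ici k, j ≠ k → y j < y k

/-- The flattest of the highest lines at a critical point determines the critical point, and its
index is a record of the sequence, read forwards or backwards. -/
theorem card_crit_le {n : ℕ} (y : Fin (n + 1) → ℝ) :
    (crit y).card ≤ (leftRecords y).card + (rightRecords y).card := by
  classical
  have hex : ∀ s, ∃ k, IsHighest y s k ∧ ∀ l, IsHighest y s l → k ≤ l := by
    intro s
    obtain ⟨k, hk⟩ := exists_isHighest y s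
    obtain ⟨m, hm, hmin⟩ := Finset.exists_min_image (Finset.univ.filter fun k => IsHighest y s k) id
      ⟨k, by simpa using hk⟩
    simp only [Finset.mem_filter, Finset.mem_univ, true_and, id] at hm hmin
    exact ⟨m, hm, hmin⟩
  choose first hfirst hmin using hex
  refine le_trans (Finset.card_le_card_of_injOn first (t := leftRecords y ∪ rightRecords y) ?_ ?_)
    (Finset.card_union_le _ _)
  · intro s _
    simp only [Finset.coe_union, Set.mem_union, Finset.mem_coe, leftRecords, rightRecords,
      Finset.mem_filter, Finset.mem_univ, true_and, Finset.mem_Iic, Finset.mem_Ici]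
    rcases le_or_gt s 0 with hs | hs
    · left
      intro j hj hne
      have hlt : j < first s := lt_of_le_of_ne hj hne
      have h1 : line y j s < line y (first s) s := by
        by_contra! h
        exact absurd (hmin s j fun i => (hfirst s i).trans h) (not_le.2 hlt)
      have : ((j : ℕ) : ℝ) < (first s : ℕ) := by exact_mod_cast hlt
      simp only [line] at h1
      nlinarith
    · right
      intro j hj hne
      have hlt : first s < j := lt_of_le_of_ne hj hne.symm
      have h1 := hfirst s j
      have : ((first s : ℕ) : ℝ) < (j : ℕ) := by exact_mod_cast hlt
      simp only [line] at h1
      nlinarith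
  · have key : ∀ s ∈ crit y, ∀ s', first s = first s' → ¬ s < s' := by
      intro s hs s' heq hlt
      obtain ⟨k, l, hkl, hk, hl⟩ := mem_crit.1 hs
      have h1 : first s < l := (hmin s k hk).trans_lt hkl
      have h2 := hl (first s)
      have h3 := hfirst s' l
      rw [← heq] at h3
      have : ((first s : ℕ) : ℝ) < (l : ℕ) := by exact_mod_cast h1
      simp only [line] at h2 h3
      nlinarith
    intro s hs s' hs' heq
    rcases lt_trichotomy s s' with h | h | h
    · exact absurd h (key s hs s' heq)
    · exact h
    · exact absurd h (key s' hs' s heq.symm)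

open Classical in
/-- In a random arrangement, the strict maximum over the positions in `A` is attained at a given
position with probability at most `1 / |A|`. -/
theorem card_perms_max_le {n : ℕ} (y : Fin (n + 1) → ℝ) (A : Finset (Fin (n + 1)))
    {k : Fin (n + 1)} (hk : k ∈ A) :
    A.card * (Finset.univ.filter fun π : Equiv.Perm (Fin (n + 1)) =>
      ∀ j ∈ A, j ≠ k → y (π j) < y (π k)).card ≤ (n + 1).factorial := by
  set E : Fin (n + 1) → Finset (Equiv.Perm (Fin (n + 1))) := fun i =>
    Finset.univ.filter fun π => ∀ j ∈ A, j ≠ i → y (π j) < y (π i) with hE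
  have hcard : ∀ i ∈ A, (E k).card ≤ (E i).card := by
    intro i hi
    refine Finset.card_le_card_of_injOn (fun π => π * Equiv.swap i k) (fun π hπ => ?_)
      fun π _ π' _ h => mul_right_cancel h
    simp only [hE, Finset.coe_filter, Finset.mem_univ, true_and, Set.mem_ofPred_eq] at hπ ⊢
    intro j hj hji
    rw [Equiv.Perm.mul_apply, Equiv.Perm.mul_apply, Equiv.swap_apply_left]
    by_cases hjk : j = k
    · subst hjk
      rw [Equiv.swap_apply_right]
      exact hπ i hi hji.symm
    · rw [Equiv.swap_apply_of_ne_of_ne hji hjk]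
      exact hπ j hj hjk
  have hdisj : ∀ i ∈ A, ∀ j ∈ A, i ≠ j → Disjoint (E i) (E j) := by
    intro i hi j hj hij
    rw [Finset.disjoint_left]
    intro π h1 h2
    simp only [hE, Finset.mem_filter, Finset.mem_univ, true_and] at h1 h2
    exact lt_asymm (h1 j hj hij.symm) (h2 i hi hij)
  calc A.card * (E k).card = ∑ _i ∈ A, (E k).card := by rw [Finset.sum_const, smul_eq_mul]
    _ ≤ ∑ i ∈ A, (E i).card := Finset.sum_le_sum hcard
    _ = (A.biUnion E).card := (Finset.card_biUnion hdisj).symm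
    _ ≤ Fintype.card (Equiv.Perm (Fin (n + 1))) := Finset.card_le_univ _
    _ = (n + 1).factorial := by rw [Fintype.card_perm, Fintype.card_fin]

theorem sum_inv_le_one_add_log (n : ℕ) :
    ∑ k : Fin (n + 1), (1 : ℝ) / ((k : ℕ) + 1) ≤ 1 + Real.log (n + 1) := by
  have h := harmonic_le_one_add_log (n + 1)
  rw [harmonic] at h
  push_cast at h
  rw [Fin.sum_univ_eq_sum_range (fun k => (1 : ℝ) / ((k : ℝ) + 1))]
  simpa only [one_div] using h

/-- In a random arrangement, the mean number of critical points is at most `2 (1 + log (n + 1))`. -/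
theorem sum_card_crit_le {n : ℕ} (y : Fin (n + 1) → ℝ) :
    ∑ π : Equiv.Perm (Fin (n + 1)), ((crit (y ∘ π)).card : ℝ)
      ≤ (n + 1).factorial * (2 * (1 + Real.log (n + 1))) := by
  classical
  have main : ∀ (A : Fin (n + 1) → Finset (Fin (n + 1))), (∀ k, k ∈ A k) →
      ∑ π : Equiv.Perm (Fin (n + 1)), ((Finset.univ.filter fun k => ∀ j ∈ A k, j ≠ k →
        (y ∘ π) j < (y ∘ π) k).card : ℝ) ≤ (n + 1).factorial * ∑ k, (1 : ℝ) / (A k).card := by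
    intro A hA
    have h1 : ∑ π : Equiv.Perm (Fin (n + 1)), (Finset.univ.filter fun k => ∀ j ∈ A k, j ≠ k →
        (y ∘ π) j < (y ∘ π) k).card = ∑ k, (Finset.univ.filter fun π : Equiv.Perm (Fin (n + 1)) =>
          ∀ j ∈ A k, j ≠ k → y (π j) < y (π k)).card := by
      simp only [Finset.card_filter]
      rw [Finset.sum_comm]
      rfl
    rw [← Nat.cast_sum, h1, Nat.cast_sum, Finset.mul_sum]
    refine Finset.sum_le_sum fun k _ => ?_
    have h2 : (0 : ℝ) < (A k).card := by
      exact_mod_cast Finset.card_pos.2 ⟨k, hA k⟩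
    rw [mul_one_div, le_div_iff₀ h2, mul_comm]
    exact_mod_cast card_perms_max_le y (A k) (hA k)
  have hl := main (fun k => Finset.Iic k) (fun k => Finset.mem_Iic.2 le_rfl)
  have hr := main (fun k => Finset.Ici k) (fun k => Finset.mem_Ici.2 le_rfl)
  have hs1 : ∑ k : Fin (n + 1), (1 : ℝ) / (Finset.Iic k).card ≤ 1 + Real.log (n + 1) := by
    refine le_trans (le_of_eq ?_) (sum_inv_le_one_add_log n)
    refine Finset.sum_congr rfl fun k _ => ?_
    rw [Fin.card_Iic]
    push_cast
    rfl
  have hs2 : ∑ k : Fin (n + 1), (1 : ℝ) / (Finset.Ici k).card ≤ 1 + Real.log (n + 1) := by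
    refine le_trans (le_of_eq ?_) (sum_inv_le_one_add_log n)
    refine Fintype.sum_equiv Fin.revPerm _ _ fun k => ?_
    rw [Fin.card_Ici, Fin.revPerm_apply, Fin.val_rev]
    congr 1
    norm_cast
    omega
  calc ∑ π : Equiv.Perm (Fin (n + 1)), ((crit (y ∘ π)).card : ℝ)
      ≤ ∑ π : Equiv.Perm (Fin (n + 1)),
        (((leftRecords (y ∘ π)).card : ℝ) + ((rightRecords (y ∘ π)).card : ℝ)) :=
        Finset.sum_le_sum fun π _ => by exact_mod_cast card_crit_le (y ∘ π)
    _ ≤ (n + 1).factorial * (1 + Real.log (n + 1)) + (n + 1).factorial * (1 + Real.log (n + 1)) := by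
        rw [Finset.sum_add_distrib]
        refine add_le_add (le_trans (le_of_eq ?_) (hl.trans ?_)) (le_trans (le_of_eq ?_) (hr.trans ?_))
        · exact Finset.sum_congr rfl fun π _ => by rw [leftRecords]
        · gcongr
        · exact Finset.sum_congr rfl fun π _ => by rw [rightRecords]
        · gcongr
    _ = _ := by ring

/-! ### Zeroes on short arcs -/

theorem pow_card_le_norm_eval_prod (s : Multiset ℂ) (z : ℂ) {c : ℝ} (hc : 0 ≤ c)
    (h : ∀ x ∈ s, c ≤ ‖z - x‖) :
    c ^ s.card ≤ ‖((s.map fun x => Polynomial.X - Polynomial.C x).prod).eval z‖ := by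
  induction s using Multiset.induction with
  | empty => simp
  | cons x s ih =>
    rw [Multiset.map_cons, Multiset.prod_cons, Polynomial.eval_mul, norm_mul, Multiset.card_cons,
      pow_succ']
    refine mul_le_mul ?_ (ih fun y hy => h y (Multiset.mem_cons_of_mem hy)) (by positivity)
      (norm_nonneg _)
    simpa using h x (Multiset.mem_cons_self x s)

theorem norm_eval_prod_le_pow_card (s : Multiset ℂ) (z : ℂ) {c : ℝ} (hc : 0 ≤ c)
    (h : ∀ x ∈ s, ‖z - x‖ ≤ c) :
    ‖((s.map fun x => Polynomial.X - Polynomial.C x).prod).eval z‖ ≤ c ^ s.card := by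
  induction s using Multiset.induction with
  | empty => simp
  | cons x s ih =>
    rw [Multiset.map_cons, Multiset.prod_cons, Polynomial.eval_mul, norm_mul, Multiset.card_cons,
      pow_succ']
    refine mul_le_mul ?_ (ih fun y hy => h y (Multiset.mem_cons_of_mem hy)) (norm_nonneg _) hc
    simpa using h x (Multiset.mem_cons_self x s)

/-- Jensen's bound for the number of zeroes in a disk that does not contain the origin, with the
growth of the polynomial measured relative to a monomial. After division by the factors that vanish in
the small disk, it is the maximum principle on the disk of five times the radius. -/
theorem two_pow_zeroCount_mul_le {P : Polynomial ℂ} (hP : P ≠ 0) {z₀ w : ℂ} {ρ : ℝ} (hρ : 0 < ρ)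
    (hz₀ : 5 * ρ < ‖z₀‖) (ν : ℕ) {H η : ℝ}
    (hH : ∀ z, ‖z - z₀‖ = 5 * ρ → ‖P.eval z‖ ≤ H * ‖z‖ ^ ν) (hw : ‖w - z₀‖ ≤ ρ)
    (hη : η * ‖w‖ ^ ν ≤ ‖P.eval w‖) :
    2 ^ zeroCount (Metric.closedBall z₀ ρ) P * η ≤ H := by
  classical
  set s := P.roots.filter fun z => z ∈ Metric.closedBall z₀ ρ with hs
  set N := s.card with hN
  have hNcount : zeroCount (Metric.closedBall z₀ ρ) P = N := by
    rw [hN, hs, zeroCount, Multiset.countP_eq_card_filter]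
  obtain ⟨g, hg⟩ := (Multiset.prod_X_sub_C_dvd_iff_le_roots hP s).2 (Multiset.filter_le _ _)
  have hsmem : ∀ x ∈ s, ‖x - z₀‖ ≤ ρ := by
    intro x hx
    rw [hs, Multiset.mem_filter, Metric.mem_closedBall, dist_eq_norm] at hx
    exact hx.2
  have hne : ∀ z, ‖z - z₀‖ ≤ 5 * ρ → z ≠ 0 := by
    rintro z hz rfl
    rw [zero_sub, norm_neg] at hz
    linarith
  have heval : ∀ z, ‖P.eval z‖
      = ‖((s.map fun x => Polynomial.X - Polynomial.C x).prod).eval z‖ * ‖g.eval z‖ := by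
    intro z
    rw [← norm_mul, ← Polynomial.eval_mul, ← hg]
  have hw5 : ‖w - z₀‖ ≤ 5 * ρ := by linarith
  have hmax : ‖g.eval w * (w⁻¹) ^ ν‖ ≤ H / (4 * ρ) ^ N := by
    refine Complex.norm_le_of_forall_mem_frontier_norm_le (f := fun z => g.eval z * (z⁻¹) ^ ν)
      (U := Metric.ball z₀ (5 * ρ)) Metric.isBounded_ball ?_ ?_ ?_
    · refine DifferentiableOn.diffContOnCl fun z hz => ?_
      rw [closure_ball z₀ (by positivity), Metric.mem_closedBall, dist_eq_norm] at hz
      refine DifferentiableAt.differentiableWithinAt ?_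
      exact g.differentiableAt.mul ((differentiableAt_inv (hne z hz)).pow ν)
    · intro z hz
      rw [frontier_ball z₀ (by positivity), Metric.mem_sphere, dist_eq_norm] at hz
      have hz0 : 0 < ‖z‖ := norm_pos_iff.2 (hne z hz.le)
      have h1 : (4 * ρ) ^ N ≤ _ := pow_card_le_norm_eval_prod s z (c := 4 * ρ) (by positivity) (by
        intro x hx
        have h2 := hsmem x hx
        have h3 := norm_sub_norm_le (z - z₀) (x - z₀)
        rw [sub_sub_sub_cancel_right] at h3
        linarith)
      have h2 := hH z hz
      rw [heval] at h2
      have h3 := (mul_le_mul_of_nonneg_right h1 (norm_nonneg (g.eval z))).trans h2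
      rw [norm_mul, norm_pow, norm_inv, inv_pow, le_div_iff₀ (by positivity),
        ← div_eq_mul_inv, div_mul_eq_mul_div, div_le_iff₀ (by positivity)]
      linarith
    · rw [closure_ball z₀ (by positivity), Metric.mem_closedBall, dist_eq_norm]
      exact hw5
  have hw0 : 0 < ‖w‖ := norm_pos_iff.2 (hne w hw5)
  have h1 : _ ≤ (2 * ρ) ^ N := norm_eval_prod_le_pow_card s w (c := 2 * ρ) (by positivity) (by
    intro x hx
    have h2 := hsmem x hx
    have h3 := norm_sub_le (w - z₀) (x - z₀)
    rw [sub_sub_sub_cancel_right] at h3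
    linarith)
  rw [norm_mul, norm_pow, norm_inv, inv_pow, le_div_iff₀ (by positivity), ← div_eq_mul_inv,
    div_mul_eq_mul_div, div_le_iff₀ (by positivity)] at hmax
  rw [heval] at hη
  have h2 := hη.trans (mul_le_mul_of_nonneg_right h1 (norm_nonneg (g.eval w)))
  have h4 : (4 * ρ) ^ N = 2 ^ N * (2 * ρ) ^ N := by rw [← mul_pow]; ring
  rw [h4] at hmax
  rw [hNcount]
  have h5 : 0 < ‖w‖ ^ ν := by positivity
  refine le_of_mul_le_mul_right ?_ h5
  calc 2 ^ N * η * ‖w‖ ^ ν = 2 ^ N * (η * ‖w‖ ^ ν) := by ring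
    _ ≤ 2 ^ N * ((2 * ρ) ^ N * ‖g.eval w‖) := by gcongr
    _ = ‖g.eval w‖ * (2 ^ N * (2 * ρ) ^ N) := by ring
    _ ≤ _ := hmax

theorem zeroCount_mono {S S' : Set ℂ} (P : Polynomial ℂ) (h : ∀ z, P.IsRoot z → z ∈ S → z ∈ S') :
    zeroCount S P ≤ zeroCount S' P := by
  classical
  rw [zeroCount, zeroCount, Multiset.countP_eq_card_filter, Multiset.countP_eq_card_filter]
  refine Multiset.card_le_card ?_
  rw [Multiset.le_filter]
  refine ⟨Multiset.filter_le _ _, fun z hz => ?_⟩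
  rw [Multiset.mem_filter] at hz
  exact h z (Polynomial.isRoot_of_mem_roots hz.1) hz.2

theorem zeroCount_union_le (S S' : Set ℂ) (P : Polynomial ℂ) :
    zeroCount (S ∪ S') P ≤ zeroCount S P + zeroCount S' P := by
  classical
  simp only [zeroCount]
  induction P.roots using Multiset.induction with
  | empty => simp
  | cons x s ih =>
    rw [Multiset.countP_cons, Multiset.countP_cons, Multiset.countP_cons]
    have h : x ∈ S ∪ S' ↔ x ∈ S ∨ x ∈ S' := Iff.rfl
    split_ifs <;> first | omega | (exfalso; tauto)

theorem zeroCount_biUnion_le {ι : Type*} (I : Finset ι) (S : ι → Set ℂ) (P : Polynomial ℂ) :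
    zeroCount (⋃ i ∈ I, S i) P ≤ ∑ i ∈ I, zeroCount (S i) P := by
  classical
  induction I using Finset.induction with
  | empty => simp [zeroCount]
  | insert i I hi ih =>
    rw [Finset.set_biUnion_insert, Finset.sum_insert hi]
    exact (zeroCount_union_le _ _ _).trans (by omega)

/-- The intercepts `log |a_k|` of the lines attached to a polynomial. -/
noncomputable def logCoeff {n : ℕ} (a : Fin (n + 1) → ℂ) (k : Fin (n + 1)) : ℝ := Real.log ‖a k‖

theorem norm_mul_pow_eq_exp_line {n : ℕ} {a : Fin (n + 1) → ℂ} (ha : ∀ k, a k ≠ 0) {r : ℝ}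
    (hr : 0 < r) (k : Fin (n + 1)) :
    ‖a k‖ * r ^ (k : ℕ) = Real.exp (line (logCoeff a) k (Real.log r)) := by
  rw [line, Real.exp_add, logCoeff, Real.exp_log (norm_pos_iff.2 (ha k)), Real.exp_nat_mul,
    Real.exp_log hr]

theorem IsHighest.maxTerm_eq {n : ℕ} {a : Fin (n + 1) → ℂ} (ha : ∀ k, a k ≠ 0) {r : ℝ}
    (hr : 0 < r) {k : Fin (n + 1)} (hk : IsHighest (logCoeff a) (Real.log r) k) :
    maxTerm a r = ‖a k‖ * r ^ (k : ℕ) := by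
  refine le_antisymm ?_ (le_maxTerm a r k)
  obtain ⟨j, hj⟩ := exists_eq_maxTerm a r
  rw [hj, norm_mul_pow_eq_exp_line ha hr, norm_mul_pow_eq_exp_line ha hr]
  exact Real.exp_le_exp.2 (hk j)

theorem sum_pow_le_third {S : Finset ℕ} (f : ℕ → ℕ) (hf : Set.InjOn f S) (h1 : ∀ k ∈ S, 1 ≤ f k) :
    ∑ k ∈ S, ((1 : ℝ) / 4) ^ f k ≤ 1 / 3 := by
  rw [← Finset.sum_image (f := fun d => ((1 : ℝ) / 4) ^ d) hf]
  obtain ⟨N, hN⟩ := (S.image f).exists_nat_subset_range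
  calc ∑ d ∈ S.image f, ((1 : ℝ) / 4) ^ d ≤ ∑ d ∈ Finset.Ico 1 N, ((1 : ℝ) / 4) ^ d := by
        refine Finset.sum_le_sum_of_subset_of_nonneg (fun d hd => ?_) fun _ _ _ => by positivity
        have h2 := Finset.mem_range.1 (hN hd)
        obtain ⟨k, hk, rfl⟩ := Finset.mem_image.1 hd
        exact Finset.mem_Ico.2 ⟨h1 k hk, h2⟩
    _ ≤ (1 / 4) ^ 1 / (1 - 1 / 4) := geom_sum_Ico_le_of_lt_one (by norm_num) (by norm_num)
    _ = 1 / 3 := by norm_num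

/-- Near each zero of a polynomial there is, on the logarithmic scale, a critical point: otherwise the
terms decay geometrically on both sides of the largest one, which dominates the sum of the others. -/
theorem exists_crit_near_root {n : ℕ} {a : Fin (n + 1) → ℂ} (ha : ∀ k, a k ≠ 0) {z : ℂ}
    (hz : z ≠ 0) (hroot : (coeffPoly a).eval z = 0) :
    ∃ c ∈ crit (logCoeff a), |Real.log ‖z‖ - c| ≤ 2 := by
  by_contra! hcon
  set y := logCoeff a with hy
  set s := Real.log ‖z‖ with hs
  have hr : 0 < ‖z‖ := norm_pos_iff.2 hz
  obtain ⟨ν, hν⟩ := exists_isHighest y s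
  set M := ‖a ν‖ * ‖z‖ ^ (ν : ℕ) with hM
  have hM0 : 0 < M := by have := norm_pos_iff.2 (ha ν); positivity
  have hexp : Real.exp (-2) ≤ 1 / 4 := by
    rw [Real.exp_neg, one_div]
    refine inv_anti₀ (by norm_num) ?_
    have h1 := Real.add_one_le_exp 1
    have h2 : Real.exp 2 = Real.exp 1 * Real.exp 1 := by rw [← Real.exp_add]; norm_num
    nlinarith
  -- `dd k` is the distance from `k` to `ν`; terms decay at least like `(1 / 4) ^ dd k`, and
  -- `2 ∑ (1 / 4) ^ d = 2 / 3 < 1`.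
  set dd : ℕ → ℕ := fun k => if k < ν then ν - k else k - ν with hdd
  have hterm : ∀ k : Fin (n + 1), k ≠ ν → ‖a k‖ * ‖z‖ ^ (k : ℕ) ≤ (1 / 4) ^ dd k * M := by
    intro k hk
    have hle : line y k s ≤ (dd k : ℕ) * (-2) + line y ν s := by
      rcases lt_or_gt_of_ne hk with h | h
      · have hd : dd k = ν - k := by simp [hdd, h]
        have h' : (k : ℕ) ≤ ν := h.le
        by_contra! hgt
        obtain ⟨c, hc, h1, h2⟩ := exists_crit_left hν (s' := s - 2) (by linarith) hk (by
          rw [hd, Nat.cast_sub h'] at hgt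
          simp only [line] at hgt ⊢
          linarith)
        have := hcon c hc
        rw [abs_of_nonneg (by linarith)] at this
        linarith
      · have h' : (ν : ℕ) ≤ k := h.le
        have hd : dd k = k - ν := by
          have : ¬ (k : ℕ) < ν := by omega
          simp only [hdd, this, if_false]
        by_contra! hgt
        obtain ⟨c, hc, h1, h2⟩ := exists_crit_right hν (s' := s + 2) (by linarith) hk (by
          rw [hd, Nat.cast_sub h'] at hgt
          simp only [line] at hgt ⊢
          linarith)
        have := hcon c hc
        rw [abs_of_nonpos (by linarith)] at this
        linarith
    rw [hM, norm_mul_pow_eq_exp_line ha hr, norm_mul_pow_eq_exp_line ha hr]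
    calc Real.exp (line y k s) ≤ Real.exp ((dd k : ℕ) * (-2) + line y ν s) := Real.exp_le_exp.2 hle
      _ = Real.exp (-2) ^ dd k * Real.exp (line y ν s) := by rw [Real.exp_add, Real.exp_nat_mul]
      _ ≤ _ := by gcongr
  rw [coeffPoly_eval, ← Finset.add_sum_erase _ _ (Finset.mem_univ ν)] at hroot
  have h1 : M ≤ ∑ k ∈ Finset.univ.erase ν, (1 / 4) ^ dd (k : Fin (n + 1)) * M := by
    calc M = ‖a ν * z ^ (ν : ℕ)‖ := by rw [norm_mul, norm_pow]
      _ = ‖∑ k ∈ Finset.univ.erase ν, a k * z ^ (k : ℕ)‖ := by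
          rw [eq_neg_of_add_eq_zero_left hroot, norm_neg]
      _ ≤ ∑ k ∈ Finset.univ.erase ν, ‖a k * z ^ (k : ℕ)‖ := norm_sum_le _ _
      _ ≤ _ := Finset.sum_le_sum fun k hk => by
          rw [norm_mul, norm_pow]
          exact hterm k (Finset.ne_of_mem_erase hk)
  have h2 : ∑ k ∈ Finset.univ.erase ν, ((1 : ℝ) / 4) ^ dd (k : Fin (n + 1)) ≤ 1 / 3 + 1 / 3 := by
    have himg : ∑ k ∈ Finset.univ.erase ν, ((1 : ℝ) / 4) ^ dd (k : Fin (n + 1))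
        ≤ ∑ k ∈ Finset.range ν ∪ Finset.Ico ((ν : ℕ) + 1) (n + 1), ((1 : ℝ) / 4) ^ dd k := by
      rw [← Finset.sum_image (s := Finset.univ.erase ν) (g := fun k : Fin (n + 1) => (k : ℕ))
        (f := fun k => ((1 : ℝ) / 4) ^ dd k) (Fin.val_injective.injOn)]
      refine Finset.sum_le_sum_of_subset_of_nonneg (fun k hk => ?_) fun _ _ _ => by positivity
      obtain ⟨j, hj, rfl⟩ := Finset.mem_image.1 hk
      have hne : (j : ℕ) ≠ ν := fun h => Finset.ne_of_mem_erase hj (Fin.ext h)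
      rw [Finset.mem_union, Finset.mem_range, Finset.mem_Ico]
      omega
    refine himg.trans ?_
    rw [Finset.sum_union (by
      rw [Finset.disjoint_left]
      intro k h1 h2
      rw [Finset.mem_range] at h1
      rw [Finset.mem_Ico] at h2
      omega)]
    refine add_le_add (sum_pow_le_third dd ?_ ?_) (sum_pow_le_third dd ?_ ?_)
    · intro i hi j hj h
      simp only [Finset.coe_range, Set.mem_Iio] at hi hj
      simp only [hdd, hi, hj, if_true] at h
      omega
    · intro i hi
      rw [Finset.mem_range] at hi
      simp only [hdd, hi, if_true]
      omega
    · intro i hi j hj h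
      simp only [Finset.coe_Ico, Set.mem_Ico] at hi hj
      have h3 : ¬ i < (ν : ℕ) := by omega
      have h4 : ¬ j < (ν : ℕ) := by omega
      simp only [hdd, h3, h4, if_false] at h
      omega
    · intro i hi
      rw [Finset.mem_Ico] at hi
      have h3 : ¬ i < (ν : ℕ) := by omega
      simp only [hdd, h3, if_false]
      omega
  rw [← Finset.sum_mul] at h1
  nlinarith

/-- The point of the curve `θ = φ(log r)` at logarithmic radius `s`. -/
noncomputable def curvePoint (φ : ℝ → ℝ) (s : ℝ) : ℂ := Complex.exp (s + Complex.I * φ s)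

theorem norm_curvePoint (φ : ℝ → ℝ) (s : ℝ) : ‖curvePoint φ s‖ = Real.exp s := by
  rw [curvePoint, Complex.norm_exp]
  simp

/-- The piece of the curve `θ = φ(log r)` with logarithmic radii in `[s₀ - ρ, s₀ + ρ]`. -/
noncomputable def curveArc (φ : ℝ → ℝ) (s₀ ρ : ℝ) : Set ℂ :=
  {z | ∃ s, |s - s₀| ≤ ρ ∧ z = curvePoint φ s}

theorem curveArc_subset_closedBall {L : ℝ} (hL : 0 ≤ L) {φ : ℝ → ℝ}
    (hφ : ∀ s s', |φ s - φ s'| ≤ L * |s - s'|) {s₀ ρ : ℝ} (hρ : (1 + L) * ρ ≤ 1) :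
    curveArc φ s₀ ρ ⊆ Metric.closedBall (curvePoint φ s₀) (2 * (1 + L) * ρ * Real.exp s₀) := by
  rintro z ⟨s, hs, rfl⟩
  rw [Metric.mem_closedBall, dist_eq_norm]
  set x : ℂ := ((s - s₀ : ℝ) : ℂ) + Complex.I * ((φ s - φ s₀ : ℝ) : ℂ) with hx
  have hfac : curvePoint φ s - curvePoint φ s₀ = curvePoint φ s₀ * (Complex.exp x - 1) := by
    rw [mul_sub, mul_one, curvePoint, curvePoint, ← Complex.exp_add, hx]
    congr 2
    push_cast
    ring
  have hxn : ‖x‖ ≤ (1 + L) * ρ := by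
    calc ‖x‖ ≤ ‖((s - s₀ : ℝ) : ℂ)‖ + ‖Complex.I * ((φ s - φ s₀ : ℝ) : ℂ)‖ := norm_add_le _ _
      _ = |s - s₀| + |φ s - φ s₀| := by
          rw [norm_mul, Complex.norm_I, one_mul, Complex.norm_real, Complex.norm_real,
            Real.norm_eq_abs, Real.norm_eq_abs]
      _ ≤ ρ + L * ρ := add_le_add hs ((hφ s s₀).trans (by gcongr))
      _ = _ := by ring
  rw [hfac, norm_mul, norm_curvePoint]
  have h1 := Complex.norm_exp_sub_one_le (hxn.trans hρ)
  have h2 := Real.exp_pos s₀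
  calc Real.exp s₀ * ‖Complex.exp x - 1‖ ≤ Real.exp s₀ * (2 * ((1 + L) * ρ)) := by
        gcongr
        exact h1.trans (by linarith)
    _ = _ := by ring

theorem abs_log_norm_sub_le {z z₀ : ℂ} {s₀ x : ℝ} (hz₀ : ‖z₀‖ = Real.exp s₀) (hx : 0 ≤ x)
    (hx1 : x ≤ 1 / 2) (h : ‖z - z₀‖ ≤ x * Real.exp s₀) : 0 < ‖z‖ ∧ |Real.log ‖z‖ - s₀| ≤ 2 * x := by
  have he := Real.exp_pos s₀
  have h1 : ‖z‖ ≤ (1 + x) * Real.exp s₀ := by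
    have := norm_sub_norm_le z z₀
    linarith
  have h2 : (1 - x) * Real.exp s₀ ≤ ‖z‖ := by
    have := norm_sub_norm_le z₀ z
    rw [norm_sub_rev] at this
    linarith
  have hpos : 0 < ‖z‖ := lt_of_lt_of_le (by nlinarith) h2
  refine ⟨hpos, abs_le.2 ⟨?_, ?_⟩⟩
  · have h3 : Real.exp (-(2 * x)) ≤ 1 - x := by
      rw [Real.exp_neg]
      refine inv_le_of_inv_le₀ (by linarith) ?_
      refine le_trans ?_ (Real.add_one_le_exp _)
      rw [inv_le_iff_one_le_mul₀ (by linarith)]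
      nlinarith
    have h4 : s₀ - 2 * x ≤ Real.log ‖z‖ := by
      rw [Real.le_log_iff_exp_le hpos]
      refine le_trans ?_ h2
      rw [sub_eq_neg_add, Real.exp_add]
      gcongr
    linarith
  · have h4 : Real.log ‖z‖ ≤ s₀ + 2 * x := by
      rw [Real.log_le_iff_le_exp hpos]
      refine h1.trans ?_
      rw [add_comm s₀, Real.exp_add]
      have := Real.add_one_le_exp (2 * x)
      refine mul_le_mul_of_nonneg_right ?_ he.le
      linarith
    linarith

theorem norm_rotPoint_sub_le (w : ℂ) {β : ℝ} (hβ : 0 ≤ β) (t : ℕ) :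
    ‖rotPoint w β t - w‖ ≤ β * t * ‖w‖ := by
  have h : rotPoint w β t - w = w * (Complex.exp (Complex.I * (β * t : ℝ)) - 1) := by
    rw [rotPoint, mul_sub, mul_one]
  have h1 := Real.norm_exp_I_mul_ofReal_sub_one_le (x := β * t)
  rw [Real.norm_eq_abs, abs_of_nonneg (by positivity)] at h1
  rw [h, norm_mul, mul_comm]
  gcongr

/-- The number of zeroes on a short arc of the curve is logarithmic in the smallness factor, unless
the polynomial is small at the sample points next to the centre of the arc. It is assumed that near
the arc no term exceeds the `ν`-th one, which is the largest at the centre, by more than a factor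
`e`. -/
theorem two_pow_zeroCount_curveArc_mul_le {L : ℝ} (hL : 0 ≤ L) {φ : ℝ → ℝ}
    (hφ : ∀ s s', |φ s - φ s'| ≤ L * |s - s'|) {n : ℕ} {a : Fin (n + 1) → ℂ} (ha : ∀ k, a k ≠ 0)
    {s₀ ρ : ℝ} (hρ0 : 0 < ρ) (hρ : 20 * (1 + L) * ρ ≤ 1) {ν : Fin (n + 1)}
    (hν : IsHighest (logCoeff a) s₀ ν)
    (hband : ∀ k s, |s - s₀| ≤ 20 * (1 + L) * ρ →
      line (logCoeff a) k s ≤ line (logCoeff a) ν s + 1)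
    {β τ : ℝ} {T : ℕ} (hβ : 0 ≤ β) (hβT : β * T ≤ ρ)
    (hns : ¬ IsSmallAt (curvePoint φ s₀) β T τ a) :
    2 ^ zeroCount (curveArc φ s₀ ρ) (coeffPoly a) * τ ≤ (n + 1) * Real.exp 1 := by
  set z₀ := curvePoint φ s₀ with hz₀
  have hz₀n : ‖z₀‖ = Real.exp s₀ := norm_curvePoint φ s₀
  have he := Real.exp_pos s₀
  have hP : coeffPoly a ≠ 0 := by
    intro h
    have h1 := coeffPoly_coeff_fin a 0
    rw [h, Polynomial.coeff_zero] at h1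
    exact ha 0 h1.symm
  rw [IsSmallAt] at hns
  push Not at hns
  obtain ⟨t, ht, hle⟩ := hns
  have haν : 0 < ‖a ν‖ := norm_pos_iff.2 (ha ν)
  rw [IsHighest.maxTerm_eq ha (by rw [hz₀n]; exact he) (k := ν) (by
    rw [hz₀n, Real.log_exp]; exact hν)] at hle
  set r := 2 * (1 + L) * ρ * Real.exp s₀ with hr
  have hr0 : 0 < r := by positivity
  have key := two_pow_zeroCount_mul_le (P := coeffPoly a) hP (z₀ := z₀) (w := rotPoint z₀ β t)
    (ρ := r) hr0 (by rw [hz₀n]; nlinarith) ν (H := (n + 1) * Real.exp 1 * ‖a ν‖) (η := τ * ‖a ν‖)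
    (by
      intro z hz
      obtain ⟨hzpos, hzlog⟩ := abs_log_norm_sub_le (x := 10 * (1 + L) * ρ) hz₀n (by positivity)
        (by linarith) (by rw [hz, hr]; linarith)
      rw [coeffPoly_eval]
      calc ‖∑ k, a k * z ^ (k : ℕ)‖ ≤ ∑ k, ‖a k * z ^ (k : ℕ)‖ := norm_sum_le _ _
        _ ≤ ∑ _k : Fin (n + 1), Real.exp 1 * (‖a ν‖ * ‖z‖ ^ (ν : ℕ)) := by
            refine Finset.sum_le_sum fun k _ => ?_
            rw [norm_mul, norm_pow, norm_mul_pow_eq_exp_line ha hzpos,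
              norm_mul_pow_eq_exp_line ha hzpos, ← Real.exp_add, Real.exp_le_exp]
            have := hband k (Real.log ‖z‖) (hzlog.trans (by linarith))
            linarith
        _ = _ := by
            rw [Finset.sum_const, Finset.card_univ, Fintype.card_fin, nsmul_eq_mul]
            push_cast
            ring)
    (by
      refine (norm_rotPoint_sub_le z₀ hβ t).trans ?_
      rw [hz₀n, hr]
      refine mul_le_mul_of_nonneg_right ?_ he.le
      have h1 : (t : ℝ) ≤ T := by exact_mod_cast ht.le
      have h2 : β * t ≤ β * T := by gcongr
      have h3 : 0 ≤ L * ρ := by positivity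
      linarith)
    (by rw [norm_rotPoint, mul_assoc]; exact hle)
  have hmono : zeroCount (curveArc φ s₀ ρ) (coeffPoly a)
      ≤ zeroCount (Metric.closedBall z₀ r) (coeffPoly a) :=
    zeroCount_mono _ fun z _ hz => curveArc_subset_closedBall hL hφ (by nlinarith) hz
  have hτ : 0 ≤ τ ∨ τ < 0 := le_or_gt 0 τ
  rcases hτ with hτ | hτ
  · have h1 : (2 : ℝ) ^ zeroCount (curveArc φ s₀ ρ) (coeffPoly a)
        ≤ 2 ^ zeroCount (Metric.closedBall z₀ r) (coeffPoly a) :=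
      pow_le_pow_right₀ (by norm_num) hmono
    refine le_of_mul_le_mul_right ?_ haν
    calc _ = 2 ^ zeroCount (curveArc φ s₀ ρ) (coeffPoly a) * (τ * ‖a ν‖) := by ring
      _ ≤ 2 ^ zeroCount (Metric.closedBall z₀ r) (coeffPoly a) * (τ * ‖a ν‖) := by gcongr
      _ ≤ _ := key
  · have h1 : (2 : ℝ) ^ zeroCount (curveArc φ s₀ ρ) (coeffPoly a) * τ ≤ 0 :=
      mul_nonpos_of_nonneg_of_nonpos (by positivity) hτ.le
    have h2 := Real.exp_pos 1
    have : 0 ≤ ((n : ℝ) + 1) * Real.exp 1 := by positivity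
    linarith

/-! ### The mean zero count over all arrangements -/

theorem half_le_log {n : ℕ} (hn : 2 ≤ n) : 1 / 2 ≤ Real.log n := by
  have h1 : Real.log 2 ≤ Real.log n :=
    Real.log_le_log (by norm_num) (by exact_mod_cast hn)
  have := Real.log_two_gt_d9
  linarith

/-- Logarithmically many intervals `[o - ρ, o + ρ]` cover `[-2, 2]` in such a way that the length of an
interval is either of order `1 / n` or small in comparison with the distance to the origin. Apart from
one interval at the origin, their centres form two geometric progressions. -/
theorem exists_log_cover {B : ℝ} (hB : 1 ≤ B) : ∃ C : ℝ, 0 < C ∧ ∀ n : ℕ, 2 ≤ n →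
    ∃ O : Finset (ℝ × ℝ), (O.card : ℝ) ≤ C * Real.log n ∧ ∀ x : ℝ, |x| ≤ 2 → ∃ q ∈ O,
      |x - q.1| ≤ q.2 ∧ 1 / (4 * B * (B + 1) * n) ≤ q.2 ∧ B * q.2 ≤ 1 ∧
      (n * (B * q.2) ≤ 1 ∨ (B + 1) * q.2 < |x|) := by
  set η : ℝ := 1 / (4 * (B + 1)) with hη
  have hη0 : 0 < η := by positivity
  have hηB : (B + 1) * η = 1 / 4 := by rw [hη]; field_simp
  set g : ℝ := 1 + η with hg
  have hg1 : 1 < g := by linarith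
  have hlg : 0 < Real.log g := Real.log_pos hg1
  have hB2 : 0 ≤ Real.log (2 * B) := Real.log_nonneg (by linarith)
  refine ⟨2 * ((2 * Real.log (2 * B) + 1) / Real.log g + 4) + 2, by positivity, fun n hn => ?_⟩
  have hl := half_le_log hn
  have hn0 : (0 : ℝ) < n := by positivity
  have hn2 : (2 : ℝ) ≤ n := by exact_mod_cast hn
  set δ : ℝ := 1 / (B * n) with hδ
  have hδ0 : 0 < δ := by positivity
  set J : ℕ := ⌈Real.log (2 * B * n) / Real.log g⌉₊ + 1 with hJ
  have hlog : Real.log (2 * B * n) = Real.log (2 * B) + Real.log n :=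
    Real.log_mul (by positivity) (by positivity)
  have hgJ : 2 * B * n < g ^ J := by
    rw [← Real.log_lt_log_iff (by positivity) (by positivity), Real.log_pow, ← div_lt_iff₀ hlg]
    have := Nat.le_ceil (Real.log (2 * B * n) / Real.log g)
    rw [hJ]
    push_cast
    linarith
  have hJle : (J : ℝ) ≤ ((2 * Real.log (2 * B) + 1) / Real.log g + 4) * Real.log n := by
    have h1 := (Nat.ceil_lt_add_one (a := Real.log (2 * B * n) / Real.log g)
      (by rw [hlog]; positivity)).le
    have h2 : (J : ℝ) ≤ Real.log (2 * B * n) / Real.log g + 2 := by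
      rw [hJ]; push_cast; linarith
    refine h2.trans ?_
    rw [add_mul, div_mul_eq_mul_div]
    refine add_le_add ?_ (by linarith)
    refine div_le_div_of_nonneg_right ?_ hlg.le
    rw [hlog]
    nlinarith
  -- The interval at the origin has length of order `1 / n`. The ratio `1 + η` of the progressions is
  -- so close to `1` that an interval around `d` of half-length `η d` reaches the next centre.
  set O : Finset (ℝ × ℝ) := insert (0, δ)
    ((Finset.range J).image (fun j => (δ * g ^ j, η * (δ * g ^ j))) ∪
      (Finset.range J).image (fun j => (-(δ * g ^ j), η * (δ * g ^ j)))) with hO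
  refine ⟨O, ?_, fun x hx => ?_⟩
  · have h1 : O.card ≤ J + J + 1 := by
      refine (Finset.card_insert_le _ _).trans ?_
      refine Nat.add_le_add_right ((Finset.card_union_le _ _).trans (Nat.add_le_add ?_ ?_)) 1
      · exact Finset.card_image_le.trans (by simp)
      · exact Finset.card_image_le.trans (by simp)
    have h2 : (O.card : ℝ) ≤ J + J + 1 := by exact_mod_cast h1
    linarith
  · have hdm : 1 / (4 * B * (B + 1) * n) = η * δ := by rw [hη, hδ]; field_simp
    have hη1 : η ≤ 1 / 4 := by nlinarith
    rcases le_or_gt |x| δ with hxδ | hxδ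
    · refine ⟨(0, δ), Finset.mem_insert_self _ _, by simpa using hxδ, ?_, ?_, Or.inl ?_⟩
      · rw [hdm]; nlinarith
      · have : B * δ = 1 / n := by rw [hδ]; field_simp
        simp only [this]
        rw [div_le_one hn0]; linarith
      · have : (n : ℝ) * (B * δ) = 1 := by rw [hδ]; field_simp
        exact this.le
    · obtain ⟨j, hj1, hj2⟩ := exists_nat_pow_near (x := |x| / δ) (y := g)
        (by rw [le_div_iff₀ hδ0]; linarith) hg1
      rw [le_div_iff₀ hδ0] at hj1
      rw [div_lt_iff₀ hδ0] at hj2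
      set d := δ * g ^ j with hd
      have hgj : 1 ≤ g ^ j := one_le_pow₀ hg1.le
      have hd0 : 0 < d := by positivity
      have hdx : d ≤ |x| := by rw [hd]; linarith
      have hxd : |x| ≤ d + η * d := by
        rw [pow_succ, hg] at hj2
        rw [hd, hg]
        nlinarith
      have hδd : δ ≤ d := by rw [hd]; nlinarith
      have hηd : 0 ≤ η * d := by positivity
      have hjJ : j < J := by
        by_contra! hle
        have h1 : g ^ J ≤ g ^ j := pow_le_pow_right₀ hg1.le hle
        have h2 : 2 * B * n * δ = 2 := by rw [hδ]; field_simp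
        have h3 : 2 * B * n * δ < g ^ j * δ := mul_lt_mul_of_pos_right (hgJ.trans_le h1) hδ0
        linarith
      have hprops : 1 / (4 * B * (B + 1) * n) ≤ η * d ∧ B * (η * d) ≤ 1 ∧
          (n * (B * (η * d)) ≤ 1 ∨ (B + 1) * (η * d) < |x|) := by
        have hBη : B * η ≤ 1 / 4 := by linarith
        refine ⟨?_, ?_, Or.inr ?_⟩
        · rw [hdm]; gcongr
        · nlinarith
        · rw [← mul_assoc, hηB]; linarith
      rcases le_total 0 x with h0 | h0
      · refine ⟨(d, η * d), ?_, ?_, hprops⟩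
        · rw [hO]
          exact Finset.mem_insert_of_mem (Finset.mem_union_left _
            (Finset.mem_image.2 ⟨j, Finset.mem_range.2 hjJ, rfl⟩))
        · rw [abs_of_nonneg h0] at hdx hxd
          change |x - d| ≤ η * d
          rw [abs_le]
          constructor <;> linarith
      · refine ⟨(-d, η * d), ?_, ?_, hprops⟩
        · rw [hO]
          exact Finset.mem_insert_of_mem (Finset.mem_union_right _
            (Finset.mem_image.2 ⟨j, Finset.mem_range.2 hjJ, rfl⟩))
        · rw [abs_of_nonpos h0] at hdx hxd
          change |x - -d| ≤ η * d
          rw [abs_le]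
          constructor <;> linarith

theorem zeroCount_coeffPoly_le {n : ℕ} (S : Set ℂ) (a : Fin (n + 1) → ℂ) :
    zeroCount S (coeffPoly a) ≤ n := by
  classical
  rw [zeroCount]
  refine (Multiset.countP_le_card _ _).trans ((Polynomial.card_roots' _).trans ?_)
  rw [Polynomial.natDegree_le_iff_coeff_eq_zero]
  intro k hk
  rw [coeffPoly_coeff, dif_neg (by omega)]

/-- If the polynomial is not small at any of the centres that the cover provides near its critical
points, then each critical point contributes at most `|O|` arcs to the zeroes on the curve. -/
theorem zeroCount_curve_le {L : ℝ} (hL : 0 ≤ L) {φ : ℝ → ℝ}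
    (hφ : ∀ s s', |φ s - φ s'| ≤ L * |s - s'|) {Γ : Set ℂ}
    (hΓ : ∀ z ∈ Γ, z ≠ 0 → ∃ s, z = curvePoint φ s) {n : ℕ} {a : Fin (n + 1) → ℂ}
    (ha : ∀ k, a k ≠ 0) {O : Finset (ℝ × ℝ)} {ρ₀ : ℝ} (hρ₀ : 0 < ρ₀)
    (hO : ∀ x : ℝ, |x| ≤ 2 → ∃ q ∈ O, |x - q.1| ≤ q.2 ∧ ρ₀ ≤ q.2 ∧ 20 * (1 + L) * q.2 ≤ 1 ∧
      (n * (20 * (1 + L) * q.2) ≤ 1 ∨ (20 * (1 + L) + 1) * q.2 < |x|))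
    {β τ : ℝ} {T : ℕ} (hβ : 0 ≤ β) (hβT : β * T ≤ ρ₀) (hτ : 0 < τ)
    (hτ1 : τ ≤ 1)
    (hns : ∀ c ∈ crit (logCoeff a), ∀ q ∈ O, ¬ IsSmallAt (curvePoint φ (c + q.1)) β T τ a) :
    (zeroCount Γ (coeffPoly a) : ℝ)
      ≤ (crit (logCoeff a)).card * O.card * (Real.log ((n + 1) * Real.exp 1 / τ) / Real.log 2) := by
  classical
  set y := logCoeff a with hy
  set D := Real.log ((n + 1) * Real.exp 1 / τ) / Real.log 2 with hD
  set G := (crit y ×ˢ O).filter fun p => (zeroCount (curveArc φ (p.1 + p.2.1) p.2.2) (coeffPoly a) : ℝ)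
    ≤ D with hG
  have hcover : zeroCount Γ (coeffPoly a)
      ≤ zeroCount (⋃ p ∈ G, curveArc φ (p.1 + p.2.1) p.2.2) (coeffPoly a) := by
    refine zeroCount_mono _ fun z hz hzΓ => ?_
    have hz0 : z ≠ 0 := by
      rintro rfl
      rw [Polynomial.IsRoot.def, ← Polynomial.coeff_zero_eq_eval_zero] at hz
      exact ha 0 (by rw [← coeffPoly_coeff_fin a 0]; exact hz)
    obtain ⟨s, rfl⟩ := hΓ z hzΓ hz0
    have hlog : Real.log ‖curvePoint φ s‖ = s := by rw [norm_curvePoint, Real.log_exp]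
    obtain ⟨c₀, hc₀, hc₀s⟩ := exists_crit_near_root ha hz0 hz
    rw [hlog] at hc₀s
    -- The zero is attributed to the nearest critical point `c`, so that no critical point is closer to
    -- `s` than `|s - c|`.
    obtain ⟨c, hc, hmin⟩ := Finset.exists_min_image (crit y) (fun c => |s - c|) ⟨c₀, hc₀⟩
    obtain ⟨q, hq, hxq, hqρ, hqB, hq2⟩ := hO (s - c) ((hmin c₀ hc₀).trans hc₀s)
    have hdist : |s - (c + q.1)| ≤ q.2 := by rwa [← sub_sub]
    rw [Set.mem_iUnion₂]
    refine ⟨(c, q), ?_, s, hdist, rfl⟩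
    rw [hG, Finset.mem_filter, Finset.mem_product]
    refine ⟨⟨hc, hq⟩, ?_⟩
    obtain ⟨ν, hν⟩ := exists_isHighest y (c + q.1)
    have hband : ∀ k s', |s' - (c + q.1)| ≤ 20 * (1 + L) * q.2 → line y k s' ≤ line y ν s' + 1 := by
      intro k s' hs'
      rcases hq2 with h | h
      · have h1 := hν k
        have h2 : |((k : ℕ) : ℝ) - (ν : ℕ)| ≤ n := by
          have hk : ((k : ℕ) : ℝ) ≤ n := by exact_mod_cast Nat.lt_succ_iff.1 k.2
          have hν' : ((ν : ℕ) : ℝ) ≤ n := by exact_mod_cast Nat.lt_succ_iff.1 ν.2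
          rw [abs_le]
          constructor <;> linarith [Nat.cast_nonneg (α := ℝ) (k : ℕ), Nat.cast_nonneg (α := ℝ) (ν : ℕ)]
        have h3 : (((k : ℕ) : ℝ) - (ν : ℕ)) * (s' - (c + q.1)) ≤ 1 := by
          refine (le_abs_self _).trans ?_
          rw [abs_mul]
          exact (mul_le_mul h2 hs' (abs_nonneg _) (Nat.cast_nonneg n)).trans h
        simp only [line] at h1 ⊢
        linarith
      · by_contra! hgt
        have hne : k ≠ ν := by
          rintro rfl
          linarith
        have hcrit : ∃ c' ∈ crit y, |c' - (c + q.1)| ≤ 20 * (1 + L) * q.2 := by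
          rcases le_total (c + q.1) s' with hle | hle
          · obtain ⟨c', hc', h1, h2⟩ := exists_crit_right hν hle hne (by linarith)
            refine ⟨c', hc', ?_⟩
            rw [abs_of_nonneg (by linarith)] at hs' ⊢
            linarith
          · obtain ⟨c', hc', h1, h2⟩ := exists_crit_left hν hle hne (by linarith)
            refine ⟨c', hc', ?_⟩
            rw [abs_of_nonpos (by linarith)] at hs' ⊢
            linarith
        obtain ⟨c', hc', h1⟩ := hcrit
        have h2 := hmin c' hc'
        have h3 := abs_sub_le s (c + q.1) c'
        rw [abs_sub_comm (c + q.1) c'] at h3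
        linarith
    have hmain := two_pow_zeroCount_curveArc_mul_le hL hφ ha (hρ₀.trans_le hqρ) hqB hν hband hβ
      (hβT.trans hqρ) (hns c hc q hq)
    have h2 : (0 : ℝ) < Real.log 2 := Real.log_pos (by norm_num)
    rw [hD, le_div_iff₀ h2, ← Real.log_pow]
    refine Real.log_le_log (by positivity) ?_
    rw [le_div_iff₀ hτ]
    exact hmain
  have hD0 : 0 ≤ D := by
    refine div_nonneg (Real.log_nonneg ?_) (Real.log_nonneg (by norm_num))
    rw [le_div_iff₀ hτ]
    have h1 := Real.add_one_le_exp 1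
    have h2 : (0 : ℝ) ≤ n := Nat.cast_nonneg n
    nlinarith
  have hsum : (zeroCount Γ (coeffPoly a) : ℝ) ≤ G.card * D := by
    calc (zeroCount Γ (coeffPoly a) : ℝ)
        ≤ ∑ p ∈ G, (zeroCount (curveArc φ (p.1 + p.2.1) p.2.2) (coeffPoly a) : ℝ) := by
          exact_mod_cast hcover.trans (zeroCount_biUnion_le G _ _)
      _ ≤ ∑ _p ∈ G, D := Finset.sum_le_sum fun p hp => (Finset.mem_filter.1 hp).2
      _ = G.card * D := by rw [Finset.sum_const, nsmul_eq_mul]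
  refine hsum.trans (mul_le_mul_of_nonneg_right ?_ hD0)
  have := Finset.card_filter_le (crit y ×ˢ O) fun p =>
    (zeroCount (curveArc φ (p.1 + p.2.1) p.2.2) (coeffPoly a) : ℝ) ≤ D
  rw [Finset.card_product] at this
  exact_mod_cast this

theorem smallFactor_le_one (n : ℕ) {β : ℝ} (hβ : 0 < β) (hβ1 : β ≤ 1) (T : ℕ) :
    smallFactor n β T ≤ 1 := by
  have hκ0 : 0 < (β / 4) ^ T := by positivity
  have hκ1 : (β / 4) ^ T ≤ 1 := pow_le_one₀ (by positivity) (by linarith)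
  have hn : (1 : ℝ) ≤ 2 * (n + 1) ^ 2 := by nlinarith [Nat.cast_nonneg (α := ℝ) n]
  have h1 : (β / 4) ^ T / (2 * ((n : ℝ) + 1) ^ 2) ≤ 1 := by
    rw [div_le_one (by positivity)]; linarith
  have h2 : 0 ≤ (β / 4) ^ T / (2 * ((n : ℝ) + 1) ^ 2) := by positivity
  rw [smallFactor]
  nlinarith

/-- The logarithm of the admissible loss is of order `log ^ 2 n` when there are `O(log n)` sample
points at distances of order `n ^ (-2)`. -/
theorem log_div_smallFactor_le {A : ℝ} (hA : 1 ≤ A) {n : ℕ} (hn : 2 ≤ n) :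
    Real.log ((n + 1) * Real.exp 1 / smallFactor n (1 / (A * n ^ 2)) (16 * (Nat.log 2 n + 1)))
      / Real.log 2 ≤ (1000 + 1000 * Real.log (4 * A)) * Real.log n ^ 2 := by
  set l := Real.log n with hl
  have hl2 : 1 / 2 ≤ l := half_le_log hn
  have hn0 : (0 : ℝ) < n := by positivity
  have hn2 : (2 : ℝ) ≤ n := by exact_mod_cast hn
  set T := 16 * (Nat.log 2 n + 1) with hT
  set β : ℝ := 1 / (A * n ^ 2) with hβ
  have hβ0 : 0 < β := by positivity
  have hlog2 : 1 / 2 ≤ Real.log 2 := by have := Real.log_two_gt_d9; linarith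
  have hlog2' : Real.log 2 ≤ 1 := by have := Real.log_two_lt_d9; linarith
  have hlogA : 0 ≤ Real.log (4 * A) := Real.log_nonneg (by linarith)
  have hlogn1 : Real.log (n + 1) ≤ 3 * l := by
    have h1 : Real.log (n + 1) ≤ Real.log (2 * n) := Real.log_le_log (by positivity) (by linarith)
    rw [Real.log_mul (by norm_num) (by positivity)] at h1
    linarith
  have hlogβ : Real.log (β / 4) = -(Real.log (4 * A) + 2 * l) := by
    have h1 : β / 4 = (4 * A * n ^ 2)⁻¹ := by rw [hβ]; field_simp
    rw [h1, Real.log_inv, Real.log_mul (by positivity) (by positivity), Real.log_pow]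
    push_cast
    ring
  have hTl : (T : ℝ) ≤ 64 * l := by
    have h1 : ((2 ^ Nat.log 2 n : ℕ) : ℝ) ≤ n := by
      exact_mod_cast Nat.pow_log_le_self 2 (by omega)
    have h2 := Real.log_le_log (by positivity) h1
    push_cast at h2
    rw [Real.log_pow] at h2
    have h3 : ((Nat.log 2 n : ℕ) : ℝ) ≤ 2 * l := by
      have h0 : (0 : ℝ) ≤ (Nat.log 2 n : ℕ) := Nat.cast_nonneg _
      nlinarith
    rw [hT]
    push_cast
    linarith
  have hτ : Real.log (smallFactor n β T)
      = -(2 * T * (Real.log (4 * A) + 2 * l) + Real.log 2 + 2 * Real.log (n + 1) + 2 * Real.log 2) := by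
    rw [smallFactor, Real.log_div (by positivity) (by norm_num),
      Real.log_mul (by positivity) (by positivity), Real.log_div (by positivity) (by positivity),
      Real.log_mul (by norm_num) (by positivity), Real.log_pow, Real.log_pow, hlogβ]
    have h4 : Real.log 4 = 2 * Real.log 2 := by
      rw [← Nat.cast_ofNat (R := ℝ) (n := 2), ← Real.log_pow]; norm_num
    rw [h4]
    push_cast
    ring
  rw [Real.log_div (by positivity) (smallFactor_pos n hβ0 T).ne',
    Real.log_mul (by positivity) (Real.exp_pos 1).ne', Real.log_exp, hτ,
    div_le_iff₀ (by linarith)]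
  have hT0 : (0 : ℝ) ≤ T := Nat.cast_nonneg T
  have h1 : (T : ℝ) * (Real.log (4 * A) + 2 * l) ≤ 64 * l * (Real.log (4 * A) + 2 * l) := by gcongr
  have h2 : l * Real.log (4 * A) ≤ 2 * (Real.log (4 * A) * l ^ 2) := by
    have : 0 ≤ Real.log (4 * A) * l * (2 * l - 1) := by
      have : 0 ≤ 2 * l - 1 := by linarith
      positivity
    nlinarith
  have h3 : l ≤ 2 * l ^ 2 := by nlinarith
  have h4 : 0 ≤ Real.log (4 * A) * l ^ 2 := by positivity
  have h5 : (1000 + 1000 * Real.log (4 * A)) * l ^ 2 * (1 / 2)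
      ≤ (1000 + 1000 * Real.log (4 * A)) * l ^ 2 * Real.log 2 := by gcongr
  nlinarith

/-- The bound for the polynomials with given coefficients in random order. An arrangement either is
small at one of the centres attached to the potential critical points, which has probability
`O(n ^ (-3))` and costs at most `n` zeroes, or has at most `O(log ^ 3 n)` zeroes on the curve for each
of its critical points, the mean number of which is `O(log n)`. -/
theorem exists_sum_zeroCount_perm_le {L : ℝ} (hL : 0 ≤ L) : ∃ C : ℝ, 0 < C ∧ ∀ n : ℕ, 2 ≤ n →
    ∀ a : Fin (n + 1) → ℂ, (∀ k, a k ≠ 0) → ∀ φ : ℝ → ℝ,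
    (∀ s s', |φ s - φ s'| ≤ L * |s - s'|) → ∀ Γ : Set ℂ,
    (∀ z ∈ Γ, z ≠ 0 → ∃ s, z = curvePoint φ s) →
    ∑ π : Equiv.Perm (Fin (n + 1)), (zeroCount Γ (coeffPoly (a ∘ π)) : ℝ)
      ≤ (n + 1).factorial * (C * Real.log n ^ 4) := by
  classical
  set B : ℝ := 20 * (1 + L) with hB
  have hB1 : 1 ≤ B := by linarith
  obtain ⟨C₁, hC₁, hcov⟩ := exists_log_cover hB1
  set A : ℝ := 64 * B * (B + 1) with hA
  have hA1 : 1 ≤ A := by nlinarith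
  have hlogA : 0 ≤ Real.log (4 * A) := Real.log_nonneg (by linarith)
  set C₂ : ℝ := 1000 + 1000 * Real.log (4 * A) with hC₂
  have hC₂0 : 0 < C₂ := by positivity
  refine ⟨10 * C₁ * C₂ + 256 * C₁, by positivity, fun n hn a ha φ hφ Γ hΓ => ?_⟩
  set l := Real.log n with hl
  have hl2 : 1 / 2 ≤ l := half_le_log hn
  have hn0 : (0 : ℝ) < n := by positivity
  have hn2 : (2 : ℝ) ≤ n := by exact_mod_cast hn
  obtain ⟨O, hOcard, hO⟩ := hcov n hn
  -- There are at most `O(n ^ 4)` arcs, so that probabilities at most `2 ^ (-m) ≤ n ^ (-7)` suffice.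
  set m := 7 * (Nat.log 2 n + 1) with hm
  set T := 16 * (Nat.log 2 n + 1) with hT
  set β : ℝ := 1 / (A * n ^ 2) with hβ
  have hβ0 : 0 < β := by positivity
  have hβ1 : β * (n + 1 : ℕ) ≤ 1 := by
    rw [hβ, div_mul_eq_mul_div, one_mul, div_le_one (by positivity)]
    push_cast
    nlinarith
  have hβ1' : β ≤ 1 := by
    rw [hβ, div_le_one (by positivity)]
    nlinarith
  have hβT : β * T ≤ 1 / (4 * B * (B + 1) * n) := by
    have h1 : (T : ℝ) ≤ 16 * n := by
      have : T ≤ 16 * n := by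
        have := Nat.log_lt_self 2 (x := n) (by omega)
        omega
      exact_mod_cast this
    calc β * T ≤ β * (16 * n) := by gcongr
      _ = 1 / (4 * B * (B + 1) * n) := by
        rw [hβ, hA]; field_simp; norm_num
  set τ := smallFactor n β T with hτ
  set y := logCoeff a with hy
  set F := slopeSet y ×ˢ O with hF
  have hD := log_div_smallFactor_le hA1 hn
  set D := Real.log ((n + 1) * Real.exp 1 / τ) / Real.log 2 with hDdef
  have hpt : ∀ π : Equiv.Perm (Fin (n + 1)), (zeroCount Γ (coeffPoly (a ∘ π)) : ℝ)
      ≤ ((crit (y ∘ π)).card : ℝ) * (C₁ * l * (C₂ * l ^ 2))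
        + n * ∑ p ∈ F, if IsSmallAt (curvePoint φ (p.1 + p.2.1)) β T τ (a ∘ π) then 1 else 0 := by
    intro π
    by_cases hbad : ∃ p ∈ F, IsSmallAt (curvePoint φ (p.1 + p.2.1)) β T τ (a ∘ π)
    · obtain ⟨p, hp, hps⟩ := hbad
      have h1 : (1 : ℝ) ≤ ∑ p ∈ F,
          if IsSmallAt (curvePoint φ (p.1 + p.2.1)) β T τ (a ∘ π) then 1 else 0 := by
        have := Finset.single_le_sum (f := fun p : ℝ × ℝ × ℝ =>
          if IsSmallAt (curvePoint φ (p.1 + p.2.1)) β T τ (a ∘ π) then (1 : ℝ) else 0)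
          (fun p _ => by positivity) hp
        simpa only [hps, if_true] using this
      have h2 : (zeroCount Γ (coeffPoly (a ∘ π)) : ℝ) ≤ n := by
        exact_mod_cast zeroCount_coeffPoly_le Γ (a ∘ π)
      have h3 : 0 ≤ ((crit (y ∘ π)).card : ℝ) * (C₁ * l * (C₂ * l ^ 2)) := by positivity
      nlinarith
    · push Not at hbad
      have h1 := zeroCount_curve_le hL hφ hΓ (a := a ∘ π) (fun k => ha _) (O := O)
        (ρ₀ := 1 / (4 * B * (B + 1) * n)) (by positivity) hO hβ0.le hβT (smallFactor_pos n hβ0 T)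
        (smallFactor_le_one n hβ0 hβ1' T) (fun c hc q hq => hbad (c, q) (by
          rw [hF, Finset.mem_product]
          exact ⟨slopeSet_comp_perm y π (crit_subset_slopeSet _ hc), hq⟩))
      have h2 : (0 : ℝ) ≤ n * ∑ p ∈ F,
          if IsSmallAt (curvePoint φ (p.1 + p.2.1)) β T τ (a ∘ π) then 1 else 0 := by positivity
      refine h1.trans (le_trans ?_ (le_add_of_nonneg_right h2))
      rw [mul_assoc]
      refine mul_le_mul_of_nonneg_left ?_ (Nat.cast_nonneg _)
      calc (O.card : ℝ) * D ≤ O.card * (C₂ * l ^ 2) := by gcongr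
        _ ≤ _ := by gcongr
  have hsmall : ∀ p ∈ F, (∑ π : Equiv.Perm (Fin (n + 1)),
      if IsSmallAt (curvePoint φ (p.1 + p.2.1)) β T τ (a ∘ π) then (1 : ℝ) else 0)
      ≤ 2 * (n + 1).factorial / n ^ 7 := by
    intro p _
    have h1 := card_perms_small_le a ha (curvePoint φ (p.1 + p.2.1)) (Complex.exp_ne_zero _) hβ0 hβ1
      (m := m) (T := T) (by omega)
    rw [Finset.sum_boole, le_div_iff₀ (by positivity)]
    have h2 : n ^ 7 ≤ 2 ^ m := by
      rw [hm, mul_comm, pow_mul]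
      exact Nat.pow_le_pow_left (Nat.lt_pow_succ_log_self (by norm_num) n).le 7
    have h3 := (Nat.mul_le_mul_left _ h2).trans h1
    exact_mod_cast h3
  have hFcard : (F.card : ℝ) ≤ 8 * n ^ 3 * (C₁ * n) := by
    have h1 : ((slopeSet y).card : ℝ) ≤ (n + 1) ^ 3 := by exact_mod_cast card_slopeSet_le y
    have h2 : ((n : ℝ) + 1) ^ 3 ≤ (2 * n) ^ 3 := by gcongr; linarith
    have h3 : l ≤ n := by
      have := Real.log_le_sub_one_of_pos hn0
      linarith
    rw [hF, Finset.card_product]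
    push_cast
    refine mul_le_mul (by linarith) (hOcard.trans (by gcongr)) (by positivity) (by positivity)
  have hcrit := sum_card_crit_le y
  have hfac : (0 : ℝ) < (n + 1).factorial := by positivity
  have hlogn1 : Real.log (n + 1) ≤ 2.5 * l := by
    have h1 : Real.log (n + 1) ≤ Real.log (2 * n) := Real.log_le_log (by positivity) (by linarith)
    rw [Real.log_mul (by norm_num) (by positivity)] at h1
    have := Real.log_two_lt_d9
    linarith
  calc ∑ π : Equiv.Perm (Fin (n + 1)), (zeroCount Γ (coeffPoly (a ∘ π)) : ℝ)
      ≤ ∑ π : Equiv.Perm (Fin (n + 1)), (((crit (y ∘ π)).card : ℝ) * (C₁ * l * (C₂ * l ^ 2))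
        + n * ∑ p ∈ F, if IsSmallAt (curvePoint φ (p.1 + p.2.1)) β T τ (a ∘ π) then 1 else 0) :=
        Finset.sum_le_sum fun π _ => hpt π
    _ = (∑ π : Equiv.Perm (Fin (n + 1)), ((crit (y ∘ π)).card : ℝ)) * (C₁ * l * (C₂ * l ^ 2))
        + n * ∑ p ∈ F, ∑ π : Equiv.Perm (Fin (n + 1)),
          if IsSmallAt (curvePoint φ (p.1 + p.2.1)) β T τ (a ∘ π) then 1 else 0 := by
        rw [Finset.sum_add_distrib, ← Finset.sum_mul, ← Finset.mul_sum, Finset.sum_comm]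
    _ ≤ ((n + 1).factorial * (10 * l)) * (C₁ * l * (C₂ * l ^ 2))
        + n * (8 * n ^ 3 * (C₁ * n) * (2 * (n + 1).factorial / n ^ 7)) := by
        refine add_le_add (mul_le_mul_of_nonneg_right (hcrit.trans ?_) (by positivity))
          (mul_le_mul_of_nonneg_left ?_ hn0.le)
        · exact mul_le_mul_of_nonneg_left (by linarith) hfac.le
        · refine (Finset.sum_le_sum hsmall).trans ?_
          rw [Finset.sum_const, nsmul_eq_mul]
          gcongr
    _ ≤ (n + 1).factorial * (10 * C₁ * C₂ * l ^ 4) + (n + 1).factorial * (256 * C₁ * l ^ 4) := by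
        refine add_le_add (le_of_eq (by ring)) ?_
        have h1 : (n : ℝ) * (8 * n ^ 3 * (C₁ * n) * (2 * (n + 1).factorial / n ^ 7))
            = (n + 1).factorial * (16 * C₁ * (1 / n ^ 2)) := by field_simp; norm_num
        rw [h1]
        refine mul_le_mul_of_nonneg_left ?_ hfac.le
        have h2 : 1 / (n : ℝ) ^ 2 ≤ 1 := by
          rw [div_le_one (by positivity)]; nlinarith
        have h3 : (1 / 2 : ℝ) ^ 4 ≤ l ^ 4 := by gcongr
        have h4 : 16 * C₁ * (1 / (n : ℝ) ^ 2) ≤ 16 * C₁ * 1 := by gcongr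
        nlinarith
    _ = _ := by ring

/-! ### Measurability and exchangeability -/

/-- The coefficients of `c (X - z_1) ⋯ (X - z_n)`. -/
noncomputable def coeffOfRoots {n : ℕ} (q : ℂ × (Fin n → ℂ)) (k : Fin (n + 1)) : ℂ :=
  (Polynomial.C q.1 * ∏ i, (Polynomial.X - Polynomial.C (q.2 i))).coeff k

theorem continuous_coeffOfRoots (n : ℕ) :
    Continuous (coeffOfRoots : ℂ × (Fin n → ℂ) → Fin (n + 1) → ℂ) := by
  have hmul : ∀ f g : ℂ × (Fin n → ℂ) → Polynomial ℂ, (∀ k, Continuous fun q => (f q).coeff k) →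
      (∀ k, Continuous fun q => (g q).coeff k) → ∀ k, Continuous fun q => (f q * g q).coeff k := by
    intro f g hf hg k
    simp only [Polynomial.coeff_mul]
    exact continuous_finsetSum _ fun p _ => (hf p.1).mul (hg p.2)
  have hC : ∀ f : ℂ × (Fin n → ℂ) → ℂ, Continuous f →
      ∀ k, Continuous fun q => (Polynomial.C (f q)).coeff k := by
    intro f hf k
    simp only [Polynomial.coeff_C]
    split_ifs
    · exact hf
    · exact continuous_const
  have hprod : ∀ (s : Finset (Fin n)) (k : ℕ), Continuous fun q : ℂ × (Fin n → ℂ) =>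
      (∏ i ∈ s, (Polynomial.X - Polynomial.C (q.2 i))).coeff k := by
    classical
    intro s
    induction s using Finset.induction with
    | empty => intro k; simp only [Finset.prod_empty]; exact continuous_const
    | insert i s hi ih =>
      simp only [Finset.prod_insert hi]
      refine hmul _ _ (fun k => ?_) ih
      simp only [Polynomial.coeff_sub]
      exact continuous_const.sub (hC _ (by fun_prop) k)
  exact continuous_pi fun k => hmul _ _ (hC _ continuous_fst) (hprod Finset.univ) k

theorem natDegree_coeffPoly {n : ℕ} {a : Fin (n + 1) → ℂ} (ha : a (Fin.last n) ≠ 0) :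
    (coeffPoly a).natDegree = n := by
  have h := coeffPoly_coeff_fin a (Fin.last n)
  refine Polynomial.natDegree_eq_of_le_of_coeff_ne_zero ?_ (by rw [Fin.val_last] at h; rwa [h])
  rw [Polynomial.natDegree_le_iff_coeff_eq_zero]
  intro k hk
  rw [coeffPoly_coeff, dif_neg (by omega)]

theorem coeffPoly_coeffOfRoots {n : ℕ} (q : ℂ × (Fin n → ℂ)) :
    coeffPoly (coeffOfRoots q) = Polynomial.C q.1 * ∏ i, (Polynomial.X - Polynomial.C (q.2 i)) := by
  ext k
  rw [coeffPoly_coeff]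
  split_ifs with h
  · rfl
  · refine (Polynomial.coeff_eq_zero_of_natDegree_lt ?_).symm
    refine (Polynomial.natDegree_C_mul_le _ _).trans_lt ?_
    rw [Polynomial.natDegree_finsetProd_X_sub_C_eq_card]
    simp
    omega

/-- The coefficient vectors with nonzero leading coefficient for which at least `m` zeroes lie in `Γ`
are those that arise from `n` zeroes, the first `m` of which lie in `Γ`. -/
theorem le_zeroCount_iff {n m : ℕ} (hm : m ≤ n) (Γ : Set ℂ) {a : Fin (n + 1) → ℂ}
    (ha : a (Fin.last n) ≠ 0) : m ≤ zeroCount Γ (coeffPoly a) ↔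
      a ∈ coeffOfRoots '' {q : ℂ × (Fin n → ℂ) | ∀ i : Fin n, (i : ℕ) < m → q.2 i ∈ Γ} := by
  classical
  constructor
  · intro hcount
    set P := coeffPoly a with hP
    set l₁ := (P.roots.filter fun z => z ∈ Γ).toList with hl₁
    set l₂ := (P.roots.filter fun z => z ∉ Γ).toList with hl₂
    have hroots : ((l₁ ++ l₂ : List ℂ) : Multiset ℂ) = P.roots := by
      rw [← Multiset.coe_add, hl₁, hl₂, Multiset.coe_toList, Multiset.coe_toList,
        Multiset.filter_add_not]
    have hdeg : P.natDegree = n := natDegree_coeffPoly ha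
    have hcard : P.roots.card = P.natDegree := IsAlgClosed.card_roots_eq_natDegree
    have hlen : (l₁ ++ l₂).length = n := by
      rw [← Multiset.coe_card, hroots, hcard, hdeg]
    have hl₁m : m ≤ l₁.length := by
      rw [hl₁, Multiset.length_toList, ← Multiset.countP_eq_card_filter]
      exact hcount
    refine ⟨(a (Fin.last n), fun i => (l₁ ++ l₂)[(i : ℕ)]'(by omega)), ?_, ?_⟩
    · intro i hi
      have h1 : (i : ℕ) < l₁.length := by omega
      simp only [List.getElem_append_left h1]
      have hmem : ∀ x ∈ l₁, x ∈ Γ := fun x hx => by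
        rw [hl₁, Multiset.mem_toList, Multiset.mem_filter] at hx
        exact hx.2
      exact hmem _ (List.getElem_mem h1)
    · have hz : (Finset.univ.val.map fun i : Fin n => (l₁ ++ l₂)[(i : ℕ)]'(by omega)) = P.roots := by
        rw [Fin.univ_val_map, ← hroots]
        congr 1
        exact List.ext_getElem (by simp only [List.length_ofFn, hlen]) (by intros; simp)
      have hfac := Polynomial.C_leadingCoeff_mul_prod_multiset_X_sub_C hcard
      have hlead : P.leadingCoeff = a (Fin.last n) := by
        rw [Polynomial.leadingCoeff, hdeg, hP, ← coeffPoly_coeff_fin a (Fin.last n), Fin.val_last]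
      rw [hlead, ← hz, Multiset.map_map] at hfac
      funext k
      rw [← coeffPoly_coeff_fin a k, ← hP, ← hfac]
      rfl
  · rintro ⟨q, hq, rfl⟩
    have hq0 : q.1 ≠ 0 := by
      intro h
      apply ha
      rw [coeffOfRoots, h, Polynomial.C_0, zero_mul, Polynomial.coeff_zero]
    have hroots : (coeffPoly (coeffOfRoots q)).roots = Finset.univ.val.map q.2 := by
      rw [coeffPoly_coeffOfRoots, Polynomial.roots_C_mul _ hq0,
        ← Polynomial.roots_multiset_prod_X_sub_C (Finset.univ.val.map q.2), Multiset.map_map]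
      rfl
    rw [zeroCount, hroots, Multiset.countP_map]
    have hsub : (Finset.univ.filter fun i : Fin n => (i : ℕ) < m)
        ⊆ Finset.univ.filter fun i : Fin n => q.2 i ∈ Γ := by
      intro i hi
      rw [Finset.mem_filter] at hi ⊢
      exact ⟨hi.1, hq i hi.2⟩
    have h1 := Finset.card_le_card hsub
    have h2 : (Finset.univ.filter fun i : Fin n => (i : ℕ) < m).card = m := by
      rw [Fin.card_filter_val_lt, min_eq_right hm]
    rw [h2] at h1
    rw [Finset.card_def, Finset.filter_val] at h1
    convert h1

open Classical in
/-- The zero count as a function of the coefficients is measurable where the leading coefficient does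
not vanish: its superlevel sets are `σ`-compact there. -/
theorem measurable_zeroCount (n : ℕ) {Γ : Set ℂ} (hΓ : IsClosed Γ) :
    Measurable fun a : Fin (n + 1) → ℂ =>
      if a (Fin.last n) ≠ 0 then zeroCount Γ (coeffPoly a) else 0 := by
  refine measurable_of_Ici fun m => ?_
  rcases Nat.eq_zero_or_pos m with rfl | hm0
  · convert MeasurableSet.univ
    ext a
    simp
  have hlast : Measurable fun a : Fin (n + 1) → ℂ => a (Fin.last n) := measurable_pi_apply _
  have hne : MeasurableSet {a : Fin (n + 1) → ℂ | a (Fin.last n) ≠ 0} :=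
    (measurableSet_eq_fun hlast measurable_const).compl
  rcases le_or_gt m n with hm | hm
  · have hclosed : IsClosed {q : ℂ × (Fin n → ℂ) | ∀ i : Fin n, (i : ℕ) < m → q.2 i ∈ Γ} := by
      simp only [Set.ofPred_forall]
      exact isClosed_iInter fun i => isClosed_iInter fun _ => hΓ.preimage (by fun_prop)
    have hsc := (isSigmaCompact_univ.of_isClosed_subset hclosed (Set.subset_univ _)).image
      (continuous_coeffOfRoots n)
    obtain ⟨K, hK, hKu⟩ := hsc
    have hmeas : MeasurableSet
        (coeffOfRoots '' {q : ℂ × (Fin n → ℂ) | ∀ i : Fin n, (i : ℕ) < m → q.2 i ∈ Γ}) := by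
      rw [← hKu]
      exact MeasurableSet.iUnion fun i => (hK i).measurableSet
    convert hne.inter hmeas using 1
    ext a
    rw [Set.mem_preimage, Set.mem_Ici, Set.mem_inter_iff, Set.mem_ofPred_eq]
    by_cases ha : a (Fin.last n) ≠ 0
    · rw [if_pos ha, le_zeroCount_iff hm Γ ha, and_iff_right ha]
    · rw [if_neg ha]
      simp only [ha, false_and, iff_false]
      omega
  · convert MeasurableSet.empty
    ext a
    rw [Set.mem_preimage, Set.mem_Ici, Set.mem_empty_iff_false, iff_false, not_le]
    have := zeroCount_coeffPoly_le Γ a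
    split_ifs <;> omega

theorem IsLipschitzCurve.isClosed {L : ℝ} {Γ : Set ℂ} (h : IsLipschitzCurve L Γ) : IsClosed Γ := by
  obtain ⟨θ, hθ, rfl⟩ := h
  have heq : {z : ℂ | ∃ r : ℝ, 0 ≤ r ∧ z = (r : ℂ) * Complex.exp (Complex.I * (θ r : ℂ))}
      = {z : ℂ | z = (‖z‖ : ℂ) * Complex.exp (Complex.I * (θ ‖z‖ : ℂ))} := by
    ext z
    constructor
    · rintro ⟨r, hr, hz⟩
      have h1 : ‖z‖ = r := by
        rw [hz, norm_mul, Complex.norm_exp_I_mul_ofReal, mul_one, Complex.norm_real,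
          Real.norm_eq_abs, abs_of_nonneg hr]
      change z = _
      rw [h1]
      exact hz
    · exact fun hz => ⟨‖z‖, norm_nonneg z, hz⟩
  rw [heq]
  refine isClosed_eq continuous_id (continuous_iff_continuousAt.2 fun z => ?_)
  have hnorm : ∀ z : ℂ, ‖(‖z‖ : ℂ) * Complex.exp (Complex.I * (θ ‖z‖ : ℂ))‖ = ‖z‖ := by
    intro z
    rw [norm_mul, Complex.norm_exp_I_mul_ofReal, mul_one, Complex.norm_real, norm_norm]
  by_cases hz : z = 0
  · subst hz
    rw [ContinuousAt, norm_zero, Complex.ofReal_zero, zero_mul]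
    refine squeeze_zero_norm (fun z => (hnorm z).le) ?_
    simpa using (continuous_norm (E := ℂ)).tendsto 0
  · have hr : 0 < ‖z‖ := norm_pos_iff.2 hz
    have hcont : ContinuousAt θ ‖z‖ := by
      rw [ContinuousAt, tendsto_iff_norm_sub_tendsto_zero]
      have hlim : Filter.Tendsto (fun r : ℝ => L * |Real.log (r / ‖z‖)|) (nhds ‖z‖) (nhds 0) := by
        have h1 : ContinuousAt (fun r : ℝ => L * |Real.log (r / ‖z‖)|) ‖z‖ :=
          ((((continuous_id.div_const _).continuousAt).log (by simp [hr.ne'])).abs).const_mul L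
        rw [ContinuousAt] at h1
        simpa [div_self hr.ne'] using h1
      refine squeeze_zero' (Filter.Eventually.of_forall fun r => norm_nonneg _) ?_ hlim
      filter_upwards [lt_mem_nhds hr] with r hr'
      exact hθ r ‖z‖ hr' hr
    have h2 : ContinuousAt (fun z : ℂ => θ ‖z‖) z :=
      ContinuousAt.comp (f := fun z : ℂ => ‖z‖) hcont continuous_norm.continuousAt
    have h3 : ContinuousAt (fun z : ℂ => (θ ‖z‖ : ℂ)) z :=
      Complex.continuous_ofReal.continuousAt.comp h2
    have h4 : ContinuousAt (fun z : ℂ => (‖z‖ : ℂ)) z :=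
      (Complex.continuous_ofReal.comp continuous_norm).continuousAt
    exact h4.mul ((continuousAt_const.mul h3).cexp)

theorem IsLipschitzCurve.exists_curvePoint {L : ℝ} {Γ : Set ℂ} (h : IsLipschitzCurve L Γ) :
    ∃ φ : ℝ → ℝ, (∀ s s', |φ s - φ s'| ≤ L * |s - s'|) ∧
      ∀ z ∈ Γ, z ≠ 0 → ∃ s, z = curvePoint φ s := by
  obtain ⟨θ, hθ, rfl⟩ := h
  refine ⟨fun s => θ (Real.exp s), fun s s' => ?_, ?_⟩
  · have := hθ _ _ (Real.exp_pos s) (Real.exp_pos s')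
    rwa [← Real.exp_sub, Real.log_exp] at this
  · rintro z ⟨r, hr, rfl⟩ hz
    have hr0 : 0 < r := by
      refine lt_of_le_of_ne hr fun h => hz ?_
      rw [← h, Complex.ofReal_zero, zero_mul]
    refine ⟨Real.log r, ?_⟩
    rw [curvePoint, Real.exp_log hr0, Complex.exp_add, ← Complex.ofReal_exp, Real.exp_log hr0]

section Probability

variable {Ω : Type*} [MeasurableSpace Ω] {μ : Measure Ω} {n : ℕ}
  {ξ : Fin (n + 1) → Ω → ℂ}

theorem IsNondegenerateIID.ae_ne_zero (h : IsNondegenerateIID μ ξ) : ∀ᵐ ω ∂μ, ∀ k, ξ k ω ≠ 0 := by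
  rw [ae_all_iff]
  intro k
  have h1 := (h.identDistrib k 0).measure_mem_eq (measurableSet_singleton (0 : ℂ))
  have h2 : μ (ξ 0 ⁻¹' {0}) = 0 := h.constant_ne_zero
  rw [h2] at h1
  rw [ae_iff]
  simpa [Set.preimage] using h1

theorem IsNondegenerateIID.measurable_vector (h : IsNondegenerateIID μ ξ)
    (π : Equiv.Perm (Fin (n + 1))) : Measurable fun ω k => ξ (π k) ω :=
  measurable_pi_lambda _ fun _ => h.measurable _

theorem IsNondegenerateIID.map_perm (h : IsNondegenerateIID μ ξ) (π : Equiv.Perm (Fin (n + 1))) :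
    μ.map (fun ω k => ξ (π k) ω) = μ.map (fun ω k => ξ k ω) := by
  rw [(h.indep.precomp π.injective).map_fun_eq_pi_map fun k => (h.measurable _).aemeasurable,
    h.indep.map_fun_eq_pi_map fun k => (h.measurable _).aemeasurable]
  congr 1
  funext k
  exact (h.identDistrib (π k) k).map_eq

open Classical in
theorem IsNondegenerateIID.zeroCount_ae_eq (h : IsNondegenerateIID μ ξ) (Γ : Set ℂ)
    (π : Equiv.Perm (Fin (n + 1))) :
    (fun ω => (zeroCount Γ (coeffPoly fun k => ξ (π k) ω) : ℝ)) =ᵐ[μ]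
      fun ω => (((fun a : Fin (n + 1) → ℂ => if a (Fin.last n) ≠ 0 then zeroCount Γ (coeffPoly a)
        else 0) (fun k => ξ (π k) ω) : ℕ) : ℝ) := by
  filter_upwards [h.ae_ne_zero] with ω hω
  simp only [ne_eq, hω, not_false_eq_true, if_true]

theorem IsNondegenerateIID.integrable_zeroCount [IsProbabilityMeasure μ]
    (h : IsNondegenerateIID μ ξ) {Γ : Set ℂ}
    (hΓ : IsClosed Γ) (π : Equiv.Perm (Fin (n + 1))) :
    Integrable (fun ω => (zeroCount Γ (coeffPoly fun k => ξ (π k) ω) : ℝ)) μ := by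
  refine Integrable.of_bound (C := n) ?_ ?_
  · refine AEStronglyMeasurable.congr ?_ (h.zeroCount_ae_eq Γ π).symm
    exact (measurable_from_top.comp
      ((measurable_zeroCount n hΓ).comp (h.measurable_vector π))).aestronglyMeasurable
  · refine Filter.Eventually.of_forall fun ω => ?_
    rw [Real.norm_eq_abs, abs_of_nonneg (Nat.cast_nonneg _)]
    exact_mod_cast zeroCount_coeffPoly_le Γ _

/-- Independent identically distributed coefficients are exchangeable. -/
theorem IsNondegenerateIID.integral_zeroCount_perm (h : IsNondegenerateIID μ ξ) {Γ : Set ℂ}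
    (hΓ : IsClosed Γ) (π : Equiv.Perm (Fin (n + 1))) :
    ∫ ω, (zeroCount Γ (coeffPoly fun k => ξ (π k) ω) : ℝ) ∂μ
      = ∫ ω, (zeroCount Γ (coeffPoly fun k => ξ k ω) : ℝ) ∂μ := by
  classical
  have key : ∀ π : Equiv.Perm (Fin (n + 1)),
      ∫ ω, (zeroCount Γ (coeffPoly fun k => ξ (π k) ω) : ℝ) ∂μ
        = ∫ a, (((fun a : Fin (n + 1) → ℂ => if a (Fin.last n) ≠ 0 then zeroCount Γ (coeffPoly a)
          else 0) a : ℕ) : ℝ) ∂(μ.map fun ω k => ξ k ω) := by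
    intro π
    rw [integral_congr_ae (h.zeroCount_ae_eq Γ π), ← h.map_perm π,
      integral_map (h.measurable_vector π).aemeasurable]
    exact (measurable_from_top.comp (measurable_zeroCount n hΓ)).aestronglyMeasurable
  rw [key π]
  exact (key 1).symm

/-- The expectation does not change when the coefficients are permuted, so that a bound for the
average over all arrangements of given coefficients carries over. -/
theorem IsNondegenerateIID.integral_zeroCount_le [IsProbabilityMeasure μ]
    (h : IsNondegenerateIID μ ξ) {Γ : Set ℂ}
    (hΓ : IsClosed Γ) {A : ℝ} (hA : ∀ a : Fin (n + 1) → ℂ, (∀ k, a k ≠ 0) →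
      ∑ π : Equiv.Perm (Fin (n + 1)), (zeroCount Γ (coeffPoly (a ∘ π)) : ℝ)
        ≤ (n + 1).factorial * A) :
    ∫ ω, (zeroCount Γ (coeffPoly fun k => ξ k ω) : ℝ) ∂μ ≤ A := by
  have hfac : (0 : ℝ) < (n + 1).factorial := by positivity
  refine le_of_mul_le_mul_left ?_ hfac
  calc ((n + 1).factorial : ℝ) * ∫ ω, (zeroCount Γ (coeffPoly fun k => ξ k ω) : ℝ) ∂μ
      = ∑ π : Equiv.Perm (Fin (n + 1)),
          ∫ ω, (zeroCount Γ (coeffPoly fun k => ξ (π k) ω) : ℝ) ∂μ := by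
        simp only [h.integral_zeroCount_perm hΓ]
        rw [Finset.sum_const, Finset.card_univ, Fintype.card_perm, Fintype.card_fin, nsmul_eq_mul]
    _ = ∫ ω, ∑ π : Equiv.Perm (Fin (n + 1)),
          (zeroCount Γ (coeffPoly fun k => ξ (π k) ω) : ℝ) ∂μ :=
        (integral_finsetSum _ fun π _ => h.integrable_zeroCount hΓ π).symm
    _ ≤ ∫ _ω, (n + 1).factorial * A ∂μ := by
        refine integral_mono_ae (integrable_finsetSum _ fun π _ => h.integrable_zeroCount hΓ π)
          (integrable_const _) ?_
        filter_upwards [h.ae_ne_zero] with ω hω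
        exact hA (fun k => ξ k ω) hω
    _ = (n + 1).factorial * A := by simp

end Probability

theorem exists_lipschitzCurve_bound {L : ℝ} (hL : 0 ≤ L) : ∃ C : ℝ, 0 < C ∧
    ∀ n : ℕ, 2 ≤ n →
    ∀ (Ω : Type*) [MeasurableSpace Ω] (μ : Measure Ω) [IsProbabilityMeasure μ]
      (ξ : Fin (n + 1) → Ω → ℂ), IsNondegenerateIID μ ξ →
    ∀ Γ : Set ℂ, IsLipschitzCurve L Γ →
      Integrable (fun ω => (zeroCount Γ (coeffPoly (fun k => ξ k ω)) : ℝ)) μ ∧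
      ∫ ω, (zeroCount Γ (coeffPoly (fun k => ξ k ω)) : ℝ) ∂μ ≤ C * Real.log n ^ 4 := by
  obtain ⟨C, hC, hbound⟩ := exists_sum_zeroCount_perm_le hL
  refine ⟨C, hC, fun n hn Ω _ μ _ ξ hξ Γ hΓ => ⟨hξ.integrable_zeroCount hΓ.isClosed 1, ?_⟩⟩
  obtain ⟨φ, hφ, hφΓ⟩ := hΓ.exists_curvePoint
  exact hξ.integral_zeroCount_le hΓ.isClosed fun a ha => hbound n hn a ha φ hφ Γ hφΓ

theorem isLipschitzCurve_ray (α : ℝ) : IsLipschitzCurve 0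
    {z : ℂ | ∃ r : ℝ, 0 ≤ r ∧ z = (r : ℂ) * Complex.exp (Complex.I * (α : ℂ))} :=
  ⟨fun _ => α, fun _ _ _ _ => by simp, rfl⟩

theorem range_ofReal_subset_rays : Set.range ((↑) : ℝ → ℂ) ⊆
    {z : ℂ | ∃ r : ℝ, 0 ≤ r ∧ z = (r : ℂ) * Complex.exp (Complex.I * ((0 : ℝ) : ℂ))} ∪
    {z : ℂ | ∃ r : ℝ, 0 ≤ r ∧ z = (r : ℂ) * Complex.exp (Complex.I * (Real.pi : ℂ))} := by
  rintro z ⟨x, rfl⟩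
  rcases le_total 0 x with hx | hx
  · exact Or.inl ⟨x, hx, by simp⟩
  · refine Or.inr ⟨-x, by linarith, ?_⟩
    rw [mul_comm Complex.I, Complex.exp_pi_mul_I]
    simp

theorem mainTheorem3 :
    (∀ L : ℝ, 0 ≤ L → ∃ C : ℝ, 0 < C ∧
      ∀ n : ℕ, 2 ≤ n →
      ∀ (Ω : Type*) [MeasurableSpace Ω] (μ : Measure Ω) [IsProbabilityMeasure μ]
        (ξ : Fin (n + 1) → Ω → ℂ), IsNondegenerateIID μ ξ →
      ∀ Γ : Set ℂ, IsLipschitzCurve L Γ →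
        Integrable (fun ω => (zeroCount Γ (coeffPoly (fun k => ξ k ω)) : ℝ)) μ ∧
        ∫ ω, (zeroCount Γ (coeffPoly (fun k => ξ k ω)) : ℝ) ∂μ ≤ C * Real.log n ^ 4) ∧
    (∃ C : ℝ, 0 < C ∧
      ∀ n : ℕ, 2 ≤ n →
      ∀ (Ω : Type*) [MeasurableSpace Ω] (μ : Measure Ω) [IsProbabilityMeasure μ]
        (ξ : Fin (n + 1) → Ω → ℂ), IsNondegenerateIID μ ξ →
        Integrable (fun ω =>
          (zeroCount (Set.range ((↑) : ℝ → ℂ)) (coeffPoly (fun k => ξ k ω)) : ℝ)) μ ∧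
        ∫ ω, (zeroCount (Set.range ((↑) : ℝ → ℂ)) (coeffPoly (fun k => ξ k ω)) : ℝ) ∂μ
          ≤ C * Real.log n ^ 4) := by
  refine ⟨fun L hL => exists_lipschitzCurve_bound hL, ?_⟩
  obtain ⟨C, hC, hbound⟩ := exists_lipschitzCurve_bound le_rfl
  refine ⟨2 * C, by positivity, fun n hn Ω _ μ _ ξ hξ => ?_⟩
  have hint := hξ.integrable_zeroCount Complex.isometry_ofReal.isClosedEmbedding.isClosed_range 1
  refine ⟨hint, ?_⟩
  obtain ⟨hi₁, hb₁⟩ := hbound n hn Ω μ ξ hξ _ (isLipschitzCurve_ray 0)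
  obtain ⟨hi₂, hb₂⟩ := hbound n hn Ω μ ξ hξ _ (isLipschitzCurve_ray Real.pi)
  have hle := integral_mono hint (hi₁.add hi₂) fun ω => by
    have := (zeroCount_mono (coeffPoly fun k => ξ k ω) fun z _ hz =>
      range_ofReal_subset_rays hz).trans (zeroCount_union_le _ _ _)
    have h := (Nat.cast_le (α := ℝ)).2 this
    rw [Nat.cast_add] at h
    exact h
  refine hle.trans ?_
  rw [integral_add' hi₁ hi₂]
  linarith
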